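/- **Setting.** Let $H, O$ be Hermitian $d\times d$ matrices, $L_1,\dots,L_J$ complex $d\times d$ matrices, $\rho_0$ a density matrix, and let $\rho$ solve the Lindblad equation $$\dot\rho=\mathcal L\rho:=-i[H,\rho]+\sum_{j}\Bigl(L_j\rho L_j^\dagger-\tfrac12\{L_j^\dagger L_j,\rho\}\Bigr),\qquad \rho(0)=\rho_0,$$ on $[0,T]$, $T\ge 1$. Let $l$ be a number with $l\ge 2\|H\|+2\sum_j\|L_j\|^2$ (operator norms). One step of the first-order Kraus integrator with time step $h$ is $$\mathcal K_h(\rho)=F_0\rho F_0^\dagger+\sum_j F_j\rho F_j^\dagger,\qquad F_0=I+\Bigl(-iH-\tfrac12\sum_j L_j^\dagger L_j\Bigr)h,\quad F_j=\sqrt h\,L_j .$$ For an integer $k\ge1$ put $f(1/k)=\mathrm{Tr}\bigl((\mathcal K_{T/k})^k[\rho_0]\,O\bigr)$; that is, $\tau=1/k$ is the step size in the rescaled time $s=t/T\in[0,1]$. Put $f(0)=\mathrm{Tr}(\rho(T)O)$. For a window length $w>0$ and $n\ge 1$ let $\xi_j=\frac w2\bigl(1-\cos\frac{(2j-1)\pi}{2n+2}\bigr)$,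 $j=1,\dots,n+1$, be the Chebyshev nodes on $[0,w]$, and let $k_j=\lceil 1/\xi_j\rceil$, $\tau_j=1/k_j$ be the perturbed (integer-step) nodes. At each node take $N_S$ shots: the $(n+1)N_S$ shots are mutually independent real random variables with values in $[-\alpha,\alpha]$, and those at node $j$ have mean $f(\tau_j)$. Let $p_n$ be the (random) polynomial of degree at most $n$ that takes at each $\tau_j$ the empirical mean of the shots at node $j$. The circuit depth at node $j$ is the number $k_j$ of integrator steps, and $d_{\max}=\max_j k_j$. **Theorem.** For all $\Lambda>0$, $\alpha>0$, $l_0>1$ there are constants $C_n,C_S>0$ such that for every $K>0$ there are constants $c\in(0,1]$ and $c_d,C_d>0$ with the following property. All these constants are independent of $d$, $J$, $H$, $L_j$, $\rho_0$, $O$, $l$, $T$, $\varepsilon$, $\delta$, $n$ and $N_S$. Suppose that $\|O\|\le\Lambda$, $l\ge l_0$, $T\ge 1$, $0<\varepsilon<e^{-1}$, $$ n\ \ge\ C_n\log\tfrac1\varepsilon,\qquad T\ \ge\ \frac{m\sqrt{\log m}}{l\sqrt{\log l}}\quad\text{with } m=\max\bigl(\log\tfrac1\varepsilon,\ \tfrac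 nK\bigr)$$ (so the condition on $T$ is $T\ge\frac{\log(1/\varepsilon)\sqrt{\log\log(1/\varepsilon)}}{l\sqrt{\log l}}$ as long as $n\le K\log\frac1\varepsilon$). Use the window $w=\dfrac{c}{(lT)^2\log l}$. Then: 1. $0<\tau_1<\tau_2<\dots<\tau_{n+1}<w$. 2. For every $\delta\in(0,1)$, if $N_S\ge C_S\,\varepsilon^{-2}\log\frac2\delta$, then $\mathbb P\bigl(|p_n(0)-f(0)|<\varepsilon\bigr)>1-\delta$. 3. The maximum circuit depth satisfies $d_{\max}=1/\tau_1$ and $$c_d\,(lT)^2\log l\; n^2\ \le\ d_{\max}\ \le\ C_d\,(lT)^2\log l\; n^2 .$$ If moreover $n\le K\log\frac1\varepsilon$, then $$c_d\,(lT)^2\log l\,\log^2\tfrac1\varepsilon\ \le\ d_{\max}\ \le\ C_d\,(lT)^2\log l\,\log^2\tfrac1\varepsilon .$$ -/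

import Mathlib

open scoped Matrix Matrix.Norms.L2Operator ComplexOrder
open MeasureTheory ProbabilityTheory

/-! In this file `‖A‖` is the `ℓ²` operator norm (largest singular value) of a complex matrix. -/

namespace LindbladRichardson

/-- The Lindblad generator
`𝓛 ρ = -i[H, ρ] + ∑ⱼ (Lⱼ ρ Lⱼ† - ½ {Lⱼ† Lⱼ, ρ})`. -/
noncomputable def lindbladian {d J : ℕ} (H : Matrix (Fin d) (Fin d) ℂ)
    (L : Fin J → Matrix (Fin d) (Fin d) ℂ) (ρ : Matrix (Fin d) (Fin d) ℂ) :
    Matrix (Fin d) (Fin d) ℂ :=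
  (-Complex.I) • (H * ρ - ρ * H) +
    ∑ j, (L j * ρ * (L j)ᴴ - (1 / 2 : ℂ) • ((L j)ᴴ * L j * ρ + ρ * ((L j)ᴴ * L j)))

/-- `ρ` solves the Lindblad equation `dρ/dt = 𝓛 ρ` on `[0, T]` with `ρ(0) = ρ₀`. -/
structure IsLindbladSolution {d J : ℕ} (H : Matrix (Fin d) (Fin d) ℂ)
    (L : Fin J → Matrix (Fin d) (Fin d) ℂ) (ρ₀ : Matrix (Fin d) (Fin d) ℂ) (T : ℝ)
    (ρ : ℝ → Matrix (Fin d) (Fin d) ℂ) : Prop where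
  initial : ρ 0 = ρ₀
  deriv : ∀ t ∈ Set.Icc 0 T,
    HasDerivWithinAt ρ (lindbladian H L (ρ t)) (Set.Icc 0 T) t

/-- Density matrices: positive semidefinite of trace one. -/
def IsDensityMatrix {d : ℕ} (ρ : Matrix (Fin d) (Fin d) ℂ) : Prop :=
  ρ.PosSemidef ∧ ρ.trace = 1

/-- The expectation value `Tr(ρ O)`. It is a real number for Hermitian `ρ` and `O`,
the only case in which it is used. -/
noncomputable def expVal {d : ℕ} (ρ O : Matrix (Fin d) (Fin d) ℂ) : ℝ :=
  (ρ * O).trace.re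

/-- The Kraus operator `F₀ = I + (-iH - ½ ∑ⱼ Lⱼ† Lⱼ) h` for the time step `h`. -/
noncomputable def krausF0 {d J : ℕ} (H : Matrix (Fin d) (Fin d) ℂ)
    (L : Fin J → Matrix (Fin d) (Fin d) ℂ) (h : ℝ) : Matrix (Fin d) (Fin d) ℂ :=
  1 + (h : ℂ) • ((-Complex.I) • H - (1 / 2 : ℂ) • ∑ j, (L j)ᴴ * L j)

/-- The Kraus operators `Fⱼ = √h Lⱼ` for the time step `h`. -/
noncomputable def krausF {d J : ℕ} (L : Fin J → Matrix (Fin d) (Fin d) ℂ) (h : ℝ) (j : Fin J) :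
    Matrix (Fin d) (Fin d) ℂ :=
  ((√h : ℝ) : ℂ) • L j

/-- One step of the first-order Kraus-form integrator,
`ρ ↦ F₀ ρ F₀† + ∑ⱼ Fⱼ ρ Fⱼ†`, with time step `h`. -/
noncomputable def krausStep {d J : ℕ} (H : Matrix (Fin d) (Fin d) ℂ)
    (L : Fin J → Matrix (Fin d) (Fin d) ℂ) (h : ℝ) (ρ : Matrix (Fin d) (Fin d) ℂ) :
    Matrix (Fin d) (Fin d) ℂ :=
  krausF0 H L h * ρ * (krausF0 H L h)ᴴ + ∑ j, krausF L h j * ρ * (krausF L h j)ᴴ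

/-- The output of the integrator at time `T` after `k` equal steps. In the rescaled time
`s = t / T ∈ [0, 1]` the step size is `τ = 1 / k`, so this is `ρ_τ(T)` for `τ = 1 / k`. -/
noncomputable def krausState {d J : ℕ} (H : Matrix (Fin d) (Fin d) ℂ)
    (L : Fin J → Matrix (Fin d) (Fin d) ℂ) (ρ₀ : Matrix (Fin d) (Fin d) ℂ) (T : ℝ) (k : ℕ) :
    Matrix (Fin d) (Fin d) ℂ :=
  (krausStep H L (T / k))^[k] ρ₀

/-- The Chebyshev nodes of the first kind mapped to `[0, w]`, in increasing order:
`ξⱼ = (w / 2) (1 - cos ((2 j - 1) π / (2 n + 2)))`, `j = 1, …, n + 1` (here `j` starts at `0`). -/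
noncomputable def chebNode (n : ℕ) (w : ℝ) (j : Fin (n + 1)) : ℝ :=
  w / 2 * (1 - Real.cos ((2 * (j : ℝ) + 1) * Real.pi / (2 * (n : ℝ) + 2)))

/-- The integer number of steps `kⱼ = ⌈1 / ξⱼ⌉` used at the `j`-th node. -/
noncomputable def numSteps (n : ℕ) (w : ℝ) (j : Fin (n + 1)) : ℕ :=
  ⌈1 / chebNode n w j⌉₊

/-- The perturbed Chebyshev nodes `τⱼ = 1 / kⱼ` (step sizes in the rescaled time `s = t / T`). -/
noncomputable def stepNode (n : ℕ) (w : ℝ) (j : Fin (n + 1)) : ℝ :=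
  1 / (numSteps n w j : ℝ)

/-- The maximum circuit depth: the largest number of integrator steps used at any node. -/
noncomputable def maxDepth (n : ℕ) (w : ℝ) : ℕ :=
  Finset.univ.sup (numSteps n w)

/-- `N` shots at each of the nodes: mutually independent real random variables with values in
`[-α, α]`, those belonging to the node `j` having mean `m j`. -/
structure IsShotFamily {Ω : Type*} [MeasurableSpace Ω] (μ : Measure Ω) {n N : ℕ}
    (X : Fin (n + 1) → Fin N → Ω → ℝ) (m : Fin (n + 1) → ℝ) (α : ℝ) : Prop where
  measurable : ∀ j s, Measurable (X j s)
  indep : iIndepFun (fun (p : Fin (n + 1) × Fin N) => X p.1 p.2) μ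
  bounded : ∀ j s, ∀ᵐ ω ∂μ, |X j s ω| ≤ α
  mean : ∀ j s, ∫ ω, X j s ω ∂μ = m j

/-- The empirical mean of the `N` shots taken at the node `j`. -/
noncomputable def sampleMean {Ω : Type*} {n N : ℕ} (X : Fin (n + 1) → Fin N → Ω → ℝ)
    (ω : Ω) (j : Fin (n + 1)) : ℝ :=
  (∑ s, X j s ω) / N

/-- Richardson extrapolation to step size zero: the value `p(0)` of the polynomial `p` of degree
at most `n` with `p (x j) = y j` for all `j`. -/
noncomputable def richardson {n : ℕ} (x y : Fin (n + 1) → ℝ) : ℝ :=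
  (Lagrange.interpolate Finset.univ x y).eval 0

end LindbladRichardson

/-! Write `F_h` for one integrator step in the Heisenberg picture, acting on observables. It has the
form `1 + h 𝓛† + h² 𝓠` with `𝓠 X = A† X A`, `A = -iH - ½ ∑ⱼ Lⱼ† Lⱼ`, so that with `h = T / k` the
simulated expectation value is `Tr (ρ₀ (F_h)ᵏ O)`.

*Analyticity in the step size.* The operator `exp (z⁻¹ log (1 + h 𝓛† + h² 𝓠))` with `h = T z` equals
`(F_h)ᵏ` at `z = 1 / k` and `exp (T 𝓛†)` at `z = 0`. It is holomorphic for `|z| < 1 / (4 (l T)²)`,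
where its exponent differs from `T 𝓛†` by at most `1` in norm. As `1 + t 𝓛†` is within `O(t²)` of a
completely positive map that is unital up to `O(t²)`, the semigroup `exp (t 𝓛†)` is contractive for
the operator norm, and the operator above is bounded by `e` on the whole disc, uniformly in `T`
(`exists_differentiableOn_interpolating_pow`, `exists_differentiableOn_expVal`). Working with
observables rather than states means that only the operator norm is needed.

*Bias.* The extrapolation weights reproduce polynomials of degree `n`. Hence the bias involves only
the Taylor coefficients of order above `n`; by Cauchy's estimate it decays like `qⁿ⁺¹`, times the
`ℓ¹` norm of the weights, where `q` compares the window to the radius of the disc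
(`norm_sum_weight_sub_le`).

*Weights.* At the exact Chebyshev nodes the weights are `cot (θⱼ / 2) / (n + 1)` up to sign, hence
`O(1 / (j + 1))`. In terms of the step numbers `xⱼ = 1 / ξⱼ` the weights are products of
`xⱼ / (xⱼ - xᵢ)`, and `|xᵢ - xⱼ| ≥ (i - j)² / (w (n + 1)²)`. The inverse gaps are therefore
summable with a bound of order `w (n + 1)²`, so that rounding the step numbers to integers changes
the weights by a bounded factor once `w (n + 1)²` is small (`abs_weight_stepNode_le`); the lower
bound on `T` provides exactly this (`mul_sq_le_of_time_bound`). The `ℓ²` norm of the weights is thus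
bounded by an absolute constant, and Hoeffding's inequality gives the stated number of shots without
a dependence on `n` (`sampleMean_concentration`).

*Depth.* The largest step number belongs to the first node, `ξ₀ = w sin² (π / (4 (n + 1)))`. -/

namespace LindbladRichardson

/-! ### The logarithm and the exponential in a Banach algebra -/

section BanachAlgebra

variable {𝔸 : Type*} [NormedRing 𝔸] [NormedAlgebra ℂ 𝔸]

/-- The power series `log (1 + X) / X = ∑ (-1) ^ r / (r + 1) X ^ r` in a Banach algebra. -/
noncomputable def logDiv (X : 𝔸) : 𝔸 :=
  ∑' r : ℕ, ((-1 : ℂ) ^ r / (r + 1)) • X ^ r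

theorem norm_logDiv_coeff_le (r : ℕ) : ‖((-1 : ℂ) ^ r / (r + 1))‖ ≤ 1 := by
  rw [norm_div, norm_pow, norm_neg, norm_one, one_pow]
  have : ‖((r : ℂ) + 1)‖ = (r : ℝ) + 1 := by
    have := Complex.norm_natCast (r + 1)
    push_cast at this
    exact this
  rw [this]
  apply div_le_one_of_le₀ <;> linarith [(Nat.cast_nonneg r : (0 : ℝ) ≤ r)]

theorem norm_logDiv_term_le [NormOneClass 𝔸] (X : 𝔸) (r : ℕ) :
    ‖((-1 : ℂ) ^ r / (r + 1)) • X ^ r‖ ≤ ‖X‖ ^ r := by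
  rw [norm_smul]
  calc _ ≤ 1 * ‖X‖ ^ r := by
        gcongr
        · exact norm_logDiv_coeff_le r
        · exact norm_pow_le X r
    _ = ‖X‖ ^ r := one_mul _

theorem norm_logDiv_le [NormOneClass 𝔸] {X : 𝔸} (hX : ‖X‖ < 1) : ‖logDiv X‖ ≤ (1 - ‖X‖)⁻¹ :=
  tsum_of_norm_bounded (hasSum_geometric_of_lt_one (norm_nonneg X) hX) (norm_logDiv_term_le X)

theorem summable_logDiv [NormOneClass 𝔸] [CompleteSpace 𝔸] {X : 𝔸} (hX : ‖X‖ < 1) :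
    Summable fun r : ℕ => ((-1 : ℂ) ^ r / (r + 1)) • X ^ r :=
  .of_norm_bounded (summable_geometric_of_lt_one (norm_nonneg X) hX) (norm_logDiv_term_le X)

theorem norm_logDiv_sub_one_le [NormOneClass 𝔸] [CompleteSpace 𝔸] {X : 𝔸} (hX : ‖X‖ < 1) :
    ‖logDiv X - 1‖ ≤ ‖X‖ * (1 - ‖X‖)⁻¹ := by
  have h : logDiv X - 1 =
      ∑' r : ℕ, ((-1 : ℂ) ^ (r + 1) / ((r + 1 : ℕ) + 1)) • X ^ (r + 1) := by
    rw [logDiv, (summable_logDiv hX).tsum_eq_zero_add]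
    simp
  rw [h]
  refine tsum_of_norm_bounded
    ((hasSum_geometric_of_lt_one (norm_nonneg X) hX).mul_left ‖X‖) fun r => ?_
  rw [← pow_succ']
  exact norm_logDiv_term_le X (r + 1)

/-- The chain rule for the exponential along a path of commuting elements. -/
theorem hasDerivAt_exp_of_commute [CompleteSpace 𝔸] {f : ℝ → 𝔸} {f' : 𝔸} {t : ℝ}
    (hf : HasDerivAt f f' t) (hc : ∀ s, Commute (f t) (f s)) :
    HasDerivAt (fun s => NormedSpace.exp (f s)) (NormedSpace.exp (f t) * f') t := by
  let _ : NormedAlgebra ℚ 𝔸 := .restrictScalars ℚ ℂ 𝔸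
  have h1 : (fun s => NormedSpace.exp (f s)) =
      fun s => NormedSpace.exp (f t) * NormedSpace.exp (f s - f t) := by
    funext s
    rw [← NormedSpace.exp_add_of_commute ((hc s).sub_right (Commute.refl _)), add_sub_cancel]
  have h2 : HasFDerivAt (NormedSpace.exp : 𝔸 → 𝔸) (1 : 𝔸 →L[ℝ] 𝔸) (f t - f t) := by
    rw [sub_self]; exact hasFDerivAt_exp_zero
  rw [h1]
  have h3 := h2.comp_hasDerivAt t (hf.sub_const (f t))
  exact h3.const_mul _

/-- The exponential of the logarithm series: `exp (log (1 + X)) = 1 + X` for `‖X‖ < 1`. The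
function `t ↦ (1 + t X) exp (-log (1 + t X))` has derivative zero. -/
theorem exp_mul_logDiv [NormOneClass 𝔸] [CompleteSpace 𝔸] {X : 𝔸} (hX : ‖X‖ < 1) :
    NormedSpace.exp (X * logDiv X) = 1 + X := by
  let _ : NormedAlgebra ℚ 𝔸 := .restrictScalars ℚ ℂ 𝔸
  -- an open interval around `[0, 1]` on which the series for `log (1 + t X)` converges
  obtain ⟨a, ha1, ha⟩ : ∃ a : ℝ, 1 < a ∧ a * ‖X‖ < 1 := by
    rcases (norm_nonneg X).eq_or_lt with h0 | h0
    · exact ⟨2, by norm_num, by rw [← h0]; norm_num⟩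
    · obtain ⟨a, h1, h2⟩ := exists_between ((one_lt_inv₀ h0).2 hX)
      exact ⟨a, h1, by rwa [← lt_div_iff₀ h0, one_div]⟩
  set G : ℕ → ℝ → 𝔸 := fun r s => (s ^ (r + 1)) • (((-1 : ℂ) ^ r / (r + 1)) • X ^ (r + 1)) with hG
  set A : ℝ → 𝔸 := fun s => ∑' r, G r s with hA
  have hGX : ∀ r s, Commute X (G r s) := fun r s =>
    (((Commute.refl X).pow_right _).smul_right _).smul_right _
  have hXA : ∀ s, Commute X (A s) := fun s => Commute.tsum_right _ fun r => hGX r s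
  have hAA : ∀ s t, Commute (A s) (A t) := fun s t => Commute.tsum_left _ fun r =>
    ((((hXA t).pow_left _).smul_left _).smul_left _)
  have hA1 : A 1 = X * logDiv X := by
    rw [hA, logDiv, ← (summable_logDiv hX).tsum_mul_left]
    refine tsum_congr fun r => ?_
    simp only [hG, one_pow, one_smul, mul_smul_comm, pow_succ' X]
  have hA0 : A 0 = 0 := by simp [hA, hG]
  -- the derivative of the logarithm is `X (1 + t X)⁻¹`, given by a geometric series
  have hder : ∀ t ∈ Set.Ioo (-a) a, HasDerivAt A (X * ∑' r : ℕ, (-(t • X)) ^ r) t := by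
    intro t ht
    have hnorm : ∀ s ∈ Set.Ioo (-a) a, ‖-(s • X)‖ ≤ a * ‖X‖ := fun s hs => by
      rw [norm_neg, norm_smul, Real.norm_eq_abs]
      gcongr
      exact (abs_lt.2 hs).le
    have ha0 : 0 ≤ a * ‖X‖ := by positivity
    rw [← (summable_geometric_of_norm_lt_one
      ((hnorm t ht).trans_lt ha)).tsum_mul_left]
    refine hasDerivAt_tsum_of_isPreconnected (g := G)
      (g' := fun r s => X * (-(s • X)) ^ r)
      ((summable_geometric_of_lt_one ha0 ha).mul_left ‖X‖) isOpen_Ioo isPreconnected_Ioo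
      (fun r s _ => ?_) (fun r s hs => ?_) (y₀ := 0) ⟨by linarith, by linarith⟩ ?_ ht
    · convert (hasDerivAt_pow (r + 1) s).smul_const (((-1 : ℂ) ^ r / (r + 1)) • X ^ (r + 1)) using 1
      have hr : ((r : ℂ) + 1) ≠ 0 := Nat.cast_add_one_ne_zero r
      rw [← neg_smul, smul_pow, mul_smul_comm, ← pow_succ', ← Complex.coe_smul, ← Complex.coe_smul,
        smul_smul]
      congr 1
      push_cast
      rw [neg_pow]
      field_simp
    · exact (norm_mul_le _ _).trans
        (by gcongr; exact (norm_pow_le _ _).trans (pow_le_pow_left₀ (norm_nonneg _) (hnorm s hs) r))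
    · simp [hG]
  have hu : ∀ t ∈ Set.Icc (0 : ℝ) 1,
      HasDerivAt (fun s : ℝ => (1 + s • X) * NormedSpace.exp (-A s)) 0 t := by
    intro t ht
    have htm : t ∈ Set.Ioo (-a) a := ⟨by linarith [ht.1], by linarith [ht.2]⟩
    have hlt : ‖-(t • X)‖ < 1 := by
      rw [norm_neg, norm_smul, Real.norm_eq_abs, abs_of_nonneg ht.1]
      nlinarith [ht.2, norm_nonneg X]
    have h1 : HasDerivAt (fun s : ℝ => 1 + s • X) X t := by
      simpa using ((hasDerivAt_id t).smul_const X).const_add 1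
    have h2 := hasDerivAt_exp_of_commute (f := fun s => -A s) (hder t htm).neg
      (fun s => ((hAA t s).neg_left).neg_right)
    refine (h1.mul h2).congr_deriv ?_
    have hc : Commute (1 + t • X) (NormedSpace.exp (-A t)) :=
      ((Commute.one_left _).add_left ((hXA t).neg_right.exp_right.smul_left t))
    have hc' : Commute X (NormedSpace.exp (-A t)) := (hXA t).neg_right.exp_right
    have hcX : Commute (1 + t • X) X :=
      (Commute.one_left _).add_left ((Commute.refl X).smul_left t)
    have hgeo := mul_neg_geom_series _ hlt
    rw [sub_neg_eq_add] at hgeo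
    rw [mul_neg, mul_neg, ← mul_assoc, hc.eq, mul_assoc, ← mul_assoc _ X, hcX.eq, mul_assoc X,
      hgeo, mul_one, hc'.eq, add_neg_cancel]
  have hconst := constant_of_has_deriv_right_zero
    (fun t ht => (hu t ht).continuousAt.continuousWithinAt)
    (fun t ht => (hu t ⟨ht.1, ht.2.le⟩).hasDerivWithinAt) 1 ⟨zero_le_one, le_rfl⟩
  simp only [one_smul, zero_smul, add_zero, hA0, neg_zero, NormedSpace.exp_zero, mul_one] at hconst
  rw [← hA1]
  calc NormedSpace.exp (A 1) = ((1 + X) * NormedSpace.exp (-A 1)) * NormedSpace.exp (A 1) := by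
        rw [hconst, one_mul]
    _ = 1 + X := by
        rw [mul_assoc, ← NormedSpace.exp_add_of_commute (Commute.refl (A 1)).neg_left,
          neg_add_cancel, NormedSpace.exp_zero, mul_one]

/-- The exponential of `A` is bounded by the exponential of the logarithmic norm of `A`, the growth
rate of `‖1 + t A‖` at `t = 0`. -/
theorem norm_exp_le_of_norm_one_add_smul_le [NormOneClass 𝔸] [CompleteSpace 𝔸] {A : 𝔸} {b C : ℝ}
    (hb : 0 ≤ b) (h : ∀ k : ℕ, 0 < k → ‖1 + (1 / k : ℝ) • A‖ ≤ 1 + b / k + C / k ^ 2) :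
    ‖NormedSpace.exp A‖ ≤ Real.exp b := by
  let _ : NormedAlgebra ℚ 𝔸 := .restrictScalars ℚ ℂ 𝔸
  have key : ∀ η : ℝ, 0 < η → ‖NormedSpace.exp A‖ ≤ Real.exp (b + η) := by
    intro η hη
    have ho : (fun y : 𝔸 => NormedSpace.exp y - 1 - y) =o[nhds 0] fun y => y := by
      have := (hasFDerivAt_exp_zero (𝕂 := ℝ) (𝔸 := 𝔸)).isLittleO
      simpa using this
    have hpos : 0 < η / 2 / (‖A‖ + 1) := by positivity
    have htend : Filter.Tendsto (fun k : ℕ => (1 / k : ℝ) • A) Filter.atTop (nhds 0) := by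
      simpa using (tendsto_one_div_atTop_nhds_zero_nat (𝕜 := ℝ)).smul_const A
    have hCt : Filter.Tendsto (fun k : ℕ => C * (1 / k : ℝ)) Filter.atTop (nhds 0) := by
      simpa using (tendsto_one_div_atTop_nhds_zero_nat (𝕜 := ℝ)).const_mul C
    have h1 := htend.eventually (ho.bound hpos)
    have h2 := hCt.eventually (eventually_lt_nhds (half_pos hη))
    obtain ⟨k, ⟨h1, h2⟩, hk⟩ := ((h1.and h2).and (Filter.eventually_gt_atTop 0)).exists
    have hk' : (0 : ℝ) < k := Nat.cast_pos.2 hk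
    have hstep : ‖NormedSpace.exp ((1 / k : ℝ) • A)‖ ≤ 1 + (b + η) / k := by
      have e1 : NormedSpace.exp ((1 / k : ℝ) • A) = (1 + (1 / k : ℝ) • A) +
          (NormedSpace.exp ((1 / k : ℝ) • A) - 1 - (1 / k : ℝ) • A) := by abel
      have e2 : ‖(1 / k : ℝ) • A‖ = ‖A‖ / k := by
        rw [norm_smul, Real.norm_eq_abs, abs_of_pos (by positivity)]; ring
      have e3 : η / 2 / (‖A‖ + 1) * (‖A‖ / k) ≤ η / 2 / k := by
        have : ‖A‖ / (‖A‖ + 1) ≤ 1 := div_le_one_of_le₀ (by linarith) (by positivity)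
        calc η / 2 / (‖A‖ + 1) * (‖A‖ / k) = η / 2 / k * (‖A‖ / (‖A‖ + 1)) := by ring
          _ ≤ η / 2 / k * 1 := by gcongr
          _ = _ := mul_one _
      have e4 : C / k ^ 2 ≤ η / 2 / k := by
        calc C / (k : ℝ) ^ 2 = C * (1 / k) / k := by ring
          _ ≤ _ := by gcongr
      rw [e2] at h1
      calc _ ≤ (1 + b / k + C / k ^ 2) + η / 2 / (‖A‖ + 1) * (‖A‖ / k) := by
            rw [e1]; exact (norm_add_le _ _).trans (add_le_add (h k hk) h1)
        _ ≤ 1 + b / k + η / 2 / k + η / 2 / k := by linarith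
        _ = _ := by ring
    have e5 : A = k • ((1 / k : ℝ) • A) := by
      rw [← Nat.cast_smul_eq_nsmul ℝ, smul_smul, mul_one_div_cancel hk'.ne', one_smul]
    calc ‖NormedSpace.exp A‖ = ‖NormedSpace.exp ((1 / k : ℝ) • A) ^ k‖ := by
          rw [← NormedSpace.exp_nsmul, ← e5]
      _ ≤ ‖NormedSpace.exp ((1 / k : ℝ) • A)‖ ^ k := norm_pow_le _ _
      _ ≤ Real.exp ((b + η) / k) ^ k := by
          gcongr
          linarith [Real.add_one_le_exp ((b + η) / k)]
      _ = Real.exp (b + η) := by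
          rw [← Real.exp_nat_mul]; congr 1; field_simp
  have ht : Filter.Tendsto (fun η : ℝ => Real.exp (b + η)) (nhdsWithin 0 (Set.Ioi 0))
      (nhds (Real.exp b)) := by
    have : Filter.Tendsto (fun η : ℝ => Real.exp (b + η)) (nhds 0) (nhds (Real.exp (b + 0))) :=
      (Continuous.tendsto (by fun_prop) 0)
    rw [add_zero] at this
    exact this.mono_left nhdsWithin_le_nhds
  exact ge_of_tendsto ht (Filter.eventually_of_mem self_mem_nhdsWithin fun η hη => key η hη)

/-- The powers `(1 + h P + h² Q) ^ k` with `h = T / k` are the values at `z = 1 / k` of a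
holomorphic function on the disc of radius `1 / (4 (l T)²)`, which is bounded by `e` if `P` generates
a contraction semigroup. The function is `z ↦ exp (z⁻¹ log (1 + h P + h² Q))` with `h = T z`, whose
exponent differs from `T P` by at most `1` on this disc. -/
theorem exists_differentiableOn_interpolating_pow [NormOneClass 𝔸] [CompleteSpace 𝔸] {P Q : 𝔸}
    {l T C : ℝ} (hl : 0 < l) (hT : 0 < T) (hlT : 1 ≤ l * T) (hP : ‖P‖ ≤ l) (hQ : ‖Q‖ ≤ l ^ 2 / 4)
    (hC : ∀ t : ℝ, 0 ≤ t → ‖1 + t • P‖ ≤ 1 + C * t ^ 2) :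
    ∃ F : ℂ → 𝔸, DifferentiableOn ℂ F (Metric.ball 0 (1 / (4 * (l * T) ^ 2))) ∧
      (∀ z ∈ Metric.ball (0 : ℂ) (1 / (4 * (l * T) ^ 2)), ‖F z‖ ≤ Real.exp 1) ∧
      F 0 = NormedSpace.exp (T • P) ∧
      ∀ k : ℕ, 0 < k → 1 / (k : ℝ) < 1 / (4 * (l * T) ^ 2) →
        F (1 / k) = (1 + (T / k : ℝ) • P + (T / k : ℝ) ^ 2 • Q) ^ k := by
  let _ : NormedAlgebra ℚ 𝔸 := .restrictScalars ℚ ℂ 𝔸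
  set R : ℝ := 1 / (4 * (l * T) ^ 2) with hR
  set X : ℂ → 𝔸 := fun z => (T * z : ℂ) • P + (T * z : ℂ) ^ 2 • Q with hX
  set E : ℂ → 𝔸 := fun z => (T : ℂ) • ((P + (T * z : ℂ) • Q) * logDiv (X z)) with hE
  have hy : ∀ z ∈ Metric.ball (0 : ℂ) R, T * ‖z‖ * l * (l * T) ≤ 1 / 4 := by
    intro z hz
    have : ‖z‖ < R := by simpa using hz
    rw [hR, lt_div_iff₀ (by positivity)] at this
    nlinarith
  have hy' : ∀ z ∈ Metric.ball (0 : ℂ) R, T * ‖z‖ * l ≤ 1 / 4 := fun z hz =>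
    le_trans (le_mul_of_one_le_right (by positivity) hlT) (hy z hz)
  have hTz : ∀ z : ℂ, ‖(T * z : ℂ)‖ = T * ‖z‖ := fun z => by
    rw [norm_mul, Complex.norm_real, Real.norm_eq_abs, abs_of_pos hT]
  have hXn : ∀ z ∈ Metric.ball (0 : ℂ) R, ‖X z‖ ≤ 17 / 16 * (T * ‖z‖ * l) := by
    intro z hz
    have h0 : 0 ≤ T * ‖z‖ := by positivity
    calc ‖X z‖ ≤ T * ‖z‖ * ‖P‖ + (T * ‖z‖) ^ 2 * ‖Q‖ := by
          refine (norm_add_le _ _).trans (le_of_eq ?_)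
          rw [norm_smul, norm_smul, norm_pow, hTz]
      _ ≤ T * ‖z‖ * l + (T * ‖z‖) ^ 2 * (l ^ 2 / 4) := by gcongr
      _ ≤ _ := by nlinarith [hy' z hz, mul_nonneg h0 hl.le]
  have hX2 : ∀ z ∈ Metric.ball (0 : ℂ) R, ‖X z‖ ≤ 1 / 2 := fun z hz => by
    linarith [hXn z hz, hy' z hz]
  have hX1 : ∀ z ∈ Metric.ball (0 : ℂ) R, ‖X z‖ < 1 := fun z hz => by linarith [hX2 z hz]
  have hXd : Differentiable ℂ X := by fun_prop
  have hinv : ∀ z ∈ Metric.ball (0 : ℂ) R, (1 - ‖X z‖)⁻¹ ≤ 2 := fun z hz =>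
    inv_le_of_inv_le₀ (by norm_num) (by linarith [hX2 z hz])
  have hlog : DifferentiableOn ℂ (fun z => logDiv (X z)) (Metric.ball 0 R) := by
    refine Complex.differentiableOn_tsum_of_summable_norm
      (summable_geometric_of_lt_one (r := 1 / 2) (by norm_num) (by norm_num))
      (fun r => ?_) Metric.isOpen_ball fun r z hz => ?_
    · exact ((hXd.pow r).const_smul ((-1 : ℂ) ^ r / (r + 1))).differentiableOn
    · exact (norm_logDiv_term_le _ r).trans (pow_le_pow_left₀ (norm_nonneg _) (hX2 z hz) r)
  refine ⟨fun z => NormedSpace.exp (E z), ?_, fun z hz => ?_, ?_, fun k hk hkR => ?_⟩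
  · have hlin : DifferentiableOn ℂ (fun z : ℂ => P + (T * z : ℂ) • Q) (Metric.ball 0 R) := by
      fun_prop
    have hEd : DifferentiableOn ℂ E (Metric.ball 0 R) :=
      (hlin.mul hlog).const_smul (T : ℂ)
    intro z hz
    exact ((NormedSpace.exp_analytic (𝕂 := ℂ) (E z)).differentiableAt).comp_differentiableWithinAt z
      (hEd z hz)
  · set B : 𝔸 := (T : ℂ) • (P * (logDiv (X z) - 1) + (T * z : ℂ) • (Q * logDiv (X z))) with hB
    have hEB : E z = T • P + B := by
      simp only [hE]
      rw [hB, ← Complex.coe_smul, ← smul_add]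
      congr 1
      rw [add_mul, mul_sub, mul_one, smul_mul_assoc]
      abel
    have hBn : ‖B‖ ≤ 1 := by
      have h1 : ‖logDiv (X z) - 1‖ ≤ 17 / 16 * (T * ‖z‖ * l) * 2 :=
        (norm_logDiv_sub_one_le (hX1 z hz)).trans
          (mul_le_mul (hXn z hz) (hinv z hz) (by simpa using (hX1 z hz).le) (by positivity))
      have h2 : ‖logDiv (X z)‖ ≤ 2 := (norm_logDiv_le (hX1 z hz)).trans (hinv z hz)
      calc ‖B‖ ≤ T * (‖P‖ * ‖logDiv (X z) - 1‖ + T * ‖z‖ * (‖Q‖ * ‖logDiv (X z)‖)) := by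
            rw [hB, norm_smul, Complex.norm_real, Real.norm_eq_abs, abs_of_pos hT]
            gcongr
            refine (norm_add_le _ _).trans (add_le_add (norm_mul_le _ _) ?_)
            rw [norm_smul, hTz]
            gcongr
            exact norm_mul_le _ _
        _ ≤ T * (l * (17 / 16 * (T * ‖z‖ * l) * 2) + T * ‖z‖ * (l ^ 2 / 4 * 2)) := by gcongr
        _ = 21 / 8 * (T * ‖z‖ * l * (l * T)) := by ring
        _ ≤ 1 := by linarith [hy z hz]
    simp only [hEB]
    refine norm_exp_le_of_norm_one_add_smul_le (C := C * T ^ 2) zero_le_one fun k hk => ?_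
    have hk' : (0 : ℝ) < k := Nat.cast_pos.2 hk
    calc ‖1 + (1 / k : ℝ) • (T • P + B)‖ = ‖(1 + (T / k : ℝ) • P) + (1 / k : ℝ) • B‖ := by
          rw [smul_add, smul_smul, add_assoc]; congr 4; ring
      _ ≤ (1 + C * (T / k) ^ 2) + 1 / k * 1 := by
          refine (norm_add_le _ _).trans (add_le_add (hC _ (by positivity)) ?_)
          rw [norm_smul, Real.norm_eq_abs, abs_of_pos (by positivity)]
          gcongr
      _ = _ := by ring
  · have h0 : X 0 = 0 := by simp [hX]
    have h1 : logDiv (0 : 𝔸) = 1 := by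
      have := norm_logDiv_sub_one_le (X := (0 : 𝔸)) (by simp)
      rw [norm_zero, zero_mul, norm_le_zero_iff, sub_eq_zero] at this
      exact this
    simp only [hE, h0, h1, mul_zero, zero_smul, add_zero, mul_one, Complex.coe_smul]
  · have hk' : (k : ℂ) ≠ 0 := Nat.cast_ne_zero.2 hk.ne'
    have hz : (1 / k : ℂ) ∈ Metric.ball (0 : ℂ) R := by simpa using hkR
    have hEk : E (1 / k) = k • (X (1 / k) * logDiv (X (1 / k))) := by
      rw [← Nat.cast_smul_eq_nsmul ℂ, ← smul_mul_assoc, hE]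
      simp only
      rw [← smul_mul_assoc, hX]
      congr 1
      simp only [smul_add, smul_smul]
      congr 2 <;> field_simp
    have hXk : X (1 / k) = (T / k : ℝ) • P + (T / k : ℝ) ^ 2 • Q := by
      rw [hX, ← Complex.coe_smul, ← Complex.coe_smul]
      push_cast
      simp only [mul_one_div]
    simp only [hEk]
    rw [NormedSpace.exp_nsmul, exp_mul_logDiv (hX1 _ hz), hXk, add_assoc]

end BanachAlgebra

/-! ### Extrapolation weights and the extrapolation of holomorphic functions -/

/-- The extrapolation weights: the values at `0` of the Lagrange basis of the nodes `x`. -/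
noncomputable def weight {n : ℕ} (x : Fin (n + 1) → ℝ) (j : Fin (n + 1)) : ℝ :=
  (Lagrange.basis Finset.univ x j).eval 0

theorem richardson_eq_sum {n : ℕ} (x y : Fin (n + 1) → ℝ) :
    richardson x y = ∑ j, y j * weight x j := by
  simp [richardson, weight, Lagrange.interpolate_apply, Polynomial.eval_finsetSum]

theorem weight_eq_prod {n : ℕ} (x : Fin (n + 1) → ℝ) (j : Fin (n + 1)) :
    weight x j = ∏ i ∈ Finset.univ.erase j, x i / (x i - x j) := by
  rw [weight, Lagrange.basis, Polynomial.eval_prod]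
  refine Finset.prod_congr rfl fun i _ => ?_
  rw [Lagrange.basisDivisor]
  simp only [Polynomial.eval_mul, Polynomial.eval_C, Polynomial.eval_sub, Polynomial.eval_X,
    zero_sub]
  rw [← neg_sub (x i) (x j), inv_neg, neg_mul_neg, div_eq_mul_inv, mul_comm]

/-- The extrapolation weights annihilate the monomials of degree `1, …, n` and sum to `1`. -/
theorem sum_pow_mul_weight {n : ℕ} {x : Fin (n + 1) → ℝ} (hx : Function.Injective x) {r : ℕ}
    (hr : r ≤ n) : ∑ j, x j ^ r * weight x j = if r = 0 then 1 else 0 := by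
  rw [← richardson_eq_sum x (fun j => x j ^ r), richardson]
  have h := Lagrange.eq_interpolate (f := (Polynomial.X ^ r : Polynomial ℝ)) (s := Finset.univ)
    (v := x) hx.injOn (by
      rw [Polynomial.degree_X_pow, Finset.card_univ, Fintype.card_fin]
      exact_mod_cast Nat.lt_succ_of_le hr)
  simp only [Polynomial.eval_pow, Polynomial.eval_X] at h
  rw [← h, Polynomial.eval_pow, Polynomial.eval_X, zero_pow_eq]

/-- Extrapolating a holomorphic function from nodes close to the origin: by the vanishing moments
of the weights, only the Taylor coefficients of order above `n` contribute to the error, and these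
are controlled by Cauchy's estimate. -/
theorem norm_sum_weight_sub_le {n : ℕ} {x : Fin (n + 1) → ℝ} (hx : Function.Injective x)
    {f : ℂ → ℂ} {R M q S : ℝ} (hR : 0 < R) (hf : DifferentiableOn ℂ f (Metric.ball 0 R))
    (hM : ∀ z ∈ Metric.ball (0 : ℂ) R, ‖f z‖ ≤ M) (hq : q < 1)
    (hxq : ∀ j, |x j| ≤ q * (R / 2)) (hS : ∑ j, |weight x j| ≤ S) :
    ‖∑ j, f (x j) * weight x j - f 0‖ ≤ M * S * (q ^ (n + 1) / (1 - q)) := by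
  have hR2 : 0 < R / 2 := half_pos hR
  have hq0 : 0 ≤ q := by
    by_contra! h
    have := hxq 0
    nlinarith [abs_nonneg (x 0)]
  have hM0 : 0 ≤ M := (norm_nonneg _).trans (hM 0 (Metric.mem_ball_self hR))
  set a : ℕ → ℂ := fun r => (r.factorial : ℂ)⁻¹ * iteratedDeriv r f 0 with ha
  have hsub : Metric.closedBall (0 : ℂ) (R / 2) ⊆ Metric.ball 0 R :=
    Metric.closedBall_subset_ball (by linarith)
  have han : ∀ r, ‖a r‖ ≤ M / (R / 2) ^ r := by
    intro r
    have hdc : DiffContOnCl ℂ f (Metric.ball 0 (R / 2)) :=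
      hf.diffContOnCl_ball hsub
    have := Complex.norm_iteratedDeriv_le_of_forall_mem_sphere_norm_le r hR2 hdc
      (fun z hz => hM z (hsub (Metric.sphere_subset_closedBall hz)))
    rw [ha, norm_mul, norm_inv, Complex.norm_natCast]
    have hfac : (0 : ℝ) < r.factorial := Nat.cast_pos.2 r.factorial_pos
    rw [inv_mul_le_iff₀ hfac, ← mul_div_assoc]
    exact this
  have hsum : ∀ j, HasSum (fun r => a r * (x j : ℂ) ^ r) (f (x j)) := by
    intro j
    have hxj : (x j : ℂ) ∈ Metric.ball (0 : ℂ) R := by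
      rw [mem_ball_zero_iff, Complex.norm_real, Real.norm_eq_abs]
      nlinarith [hxq j]
    have := Complex.hasSum_taylorSeries_on_ball hf hxj
    refine this.congr_fun fun r => ?_
    simp only [ha, sub_zero, smul_eq_mul]
    ring
  have ha0 : a 0 = f 0 := by simp [ha]
  -- the contribution of the `r`-th Taylor coefficient to the extrapolated value
  set c : ℕ → ℂ := fun r => a r * ((∑ j, x j ^ r * weight x j : ℝ) : ℂ) with hc
  have hsumc : HasSum c (∑ j, f (x j) * weight x j) := by
    have := hasSum_sum (s := Finset.univ) fun j _ => (hsum j).mul_right (weight x j : ℂ)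
    refine this.congr_fun fun r => ?_
    simp only [hc]
    push_cast
    rw [Finset.mul_sum]
    exact Finset.sum_congr rfl fun j _ => by ring
  have htail := (hasSum_nat_add_iff' (n + 1)).2 hsumc
  have hhead : ∑ r ∈ Finset.range (n + 1), c r = f 0 := by
    rw [Finset.sum_eq_single_of_mem 0 (by simp)]
    · simp only [hc]
      rw [sum_pow_mul_weight hx (Nat.zero_le n), ha0]; simp
    · intro r hr h0
      simp only [hc]
      rw [sum_pow_mul_weight hx (Nat.lt_succ_iff.1 (Finset.mem_range.1 hr))]; simp [h0]
  rw [hhead] at htail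
  have hcn : ∀ r, ‖c r‖ ≤ M * S * q ^ r := by
    intro r
    have h1 : ‖((∑ j, x j ^ r * weight x j : ℝ) : ℂ)‖ ≤ (q * (R / 2)) ^ r * S := by
      rw [Complex.norm_real, Real.norm_eq_abs]
      calc |∑ j, x j ^ r * weight x j| ≤ ∑ j, |x j ^ r * weight x j| :=
            Finset.abs_sum_le_sum_abs _ _
        _ ≤ ∑ j, (q * (R / 2)) ^ r * |weight x j| := by
            refine Finset.sum_le_sum fun j _ => ?_
            rw [abs_mul, abs_pow]
            gcongr
            exact hxq j
        _ ≤ _ := by rw [← Finset.mul_sum]; gcongr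
    calc ‖c r‖ ≤ M / (R / 2) ^ r * ((q * (R / 2)) ^ r * S) := by
          rw [hc, norm_mul]; gcongr; exact han r
      _ = _ := by rw [mul_pow]; field_simp
  have hgeo := ((hasSum_geometric_of_lt_one hq0 hq).mul_left (M * S * q ^ (n + 1)))
  refine (htail.norm_le_of_bounded hgeo fun r => ?_).trans (le_of_eq (by ring))
  rw [mul_assoc, ← pow_add, add_comm (n + 1)]
  exact hcn _

/-! ### Chebyshev nodes and numbers of steps -/

/-- The angles `(2 j + 1) π / (2 n + 2)` of the Chebyshev nodes. -/
noncomputable def chebAngle (n : ℕ) (j : Fin (n + 1)) : ℝ :=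
  (2 * (j : ℝ) + 1) * Real.pi / (2 * (n : ℝ) + 2)

theorem chebNode_eq (n : ℕ) (w : ℝ) (j : Fin (n + 1)) :
    chebNode n w j = w / 2 * (1 - Real.cos (chebAngle n j)) := rfl

theorem chebAngle_pos (n : ℕ) (j : Fin (n + 1)) : 0 < chebAngle n j := by
  have := Real.pi_pos
  unfold chebAngle
  positivity

theorem chebAngle_lt_pi (n : ℕ) (j : Fin (n + 1)) : chebAngle n j < Real.pi := by
  have hj : (j : ℝ) ≤ n := by exact_mod_cast Nat.lt_succ_iff.1 j.2
  rw [chebAngle, div_lt_iff₀ (by positivity)]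
  nlinarith [Real.pi_pos]

theorem half_chebAngle_sub (n : ℕ) (i j : Fin (n + 1)) :
    2 / Real.pi * ((chebAngle n i - chebAngle n j) / 2) = ((i : ℝ) - j) / (n + 1) := by
  have := Real.pi_pos.ne'
  have hn : (n : ℝ) + 1 ≠ 0 := by positivity
  unfold chebAngle
  field_simp
  ring

theorem chebNode_pos {n : ℕ} {w : ℝ} (hw : 0 < w) (j : Fin (n + 1)) : 0 < chebNode n w j := by
  have h1 := Real.cos_lt_cos_of_nonneg_of_le_pi le_rfl (chebAngle_lt_pi n j).le (chebAngle_pos n j)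
  rw [Real.cos_zero] at h1
  rw [chebNode_eq]
  exact mul_pos (half_pos hw) (by linarith)

theorem chebNode_lt {n : ℕ} {w : ℝ} (hw : 0 < w) (j : Fin (n + 1)) : chebNode n w j < w := by
  have h1 := Real.cos_lt_cos_of_nonneg_of_le_pi (chebAngle_pos n j).le le_rfl (chebAngle_lt_pi n j)
  rw [Real.cos_pi] at h1
  rw [chebNode_eq]
  nlinarith

/-- The gaps between Chebyshev nodes are at least quadratic in the difference of the indices: both
sines in `ξᵢ - ξⱼ = w sin ((θᵢ + θⱼ) / 2) sin ((θᵢ - θⱼ) / 2)` are at least `(i - j) / (n + 1)`. -/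
theorem chebNode_sub_ge {n : ℕ} {w : ℝ} (hw : 0 < w) {i j : Fin (n + 1)} (hji : j < i) :
    w * (((i : ℝ) - j) / (n + 1)) ^ 2 ≤ chebNode n w i - chebNode n w j := by
  have hpi := Real.pi_pos
  have hij : (0 : ℝ) ≤ (i : ℝ) - j := sub_nonneg.2 (by exact_mod_cast hji.le)
  set a := (chebAngle n i - chebAngle n j) / 2 with ha
  set s := (chebAngle n i + chebAngle n j) / 2 with hs
  have hsub : 2 / Real.pi * a = ((i : ℝ) - j) / (n + 1) := half_chebAngle_sub n i j
  have hd0 : (0 : ℝ) ≤ ((i : ℝ) - j) / (n + 1) := by positivity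
  have ha0 : 0 ≤ a := by
    rw [← hsub] at hd0
    exact nonneg_of_mul_nonneg_right hd0 (by positivity)
  have hi := chebAngle_lt_pi n i
  have hj := chebAngle_pos n j
  have h1 : 2 / Real.pi * a ≤ Real.sin a := Real.mul_le_sin ha0 (by linarith)
  -- `s` is at distance at least `a` from both `0` and `π`
  have h2 : 2 / Real.pi * a ≤ Real.sin s := by
    rcases le_total s (Real.pi / 2) with h | h
    · refine le_trans ?_ (Real.mul_le_sin (by linarith) h)
      gcongr
      linarith
    · rw [← Real.sin_pi_sub]
      refine le_trans ?_ (Real.mul_le_sin (by linarith) (by linarith))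
      gcongr
      linarith
  have hprod : chebNode n w i - chebNode n w j = w * (Real.sin s * Real.sin a) := by
    have := Real.cos_sub_cos (chebAngle n i) (chebAngle n j)
    rw [chebNode_eq, chebNode_eq]
    linear_combination (-w / 2) * this
  rw [hprod, ← hsub, sq]
  have h0 : 0 ≤ 2 / Real.pi * a := by positivity
  exact mul_le_mul_of_nonneg_left (mul_le_mul h2 h1 h0 (h0.trans h2)) hw.le

theorem inv_chebNode_sub_ge {n : ℕ} {w : ℝ} (hw : 0 < w) {i j : Fin (n + 1)} (hji : j < i) :
    ((i : ℝ) - j) ^ 2 / (w * (n + 1) ^ 2) ≤ 1 / chebNode n w j - 1 / chebNode n w i := by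
  have hi := chebNode_pos hw i
  have hj := chebNode_pos hw j
  rw [div_sub_div _ _ hj.ne' hi.ne', one_mul, mul_one, le_div_iff₀ (mul_pos hj hi)]
  have hi' := (chebNode_lt hw i).le
  have hj' := (chebNode_lt hw j).le
  calc ((i : ℝ) - j) ^ 2 / (w * (n + 1) ^ 2) * (chebNode n w j * chebNode n w i)
      ≤ ((i : ℝ) - j) ^ 2 / (w * (n + 1) ^ 2) * (w * w) := by gcongr
    _ = w * (((i : ℝ) - j) / (n + 1)) ^ 2 := by field_simp
    _ ≤ _ := chebNode_sub_ge hw hji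

theorem abs_inv_chebNode_sub_ge {n : ℕ} {w : ℝ} (hw : 0 < w) {i j : Fin (n + 1)} (hij : i ≠ j) :
    ((i : ℝ) - j) ^ 2 / (w * (n + 1) ^ 2) ≤ |1 / chebNode n w j - 1 / chebNode n w i| := by
  rcases lt_or_gt_of_ne hij with h | h
  · rw [abs_sub_comm, sub_sq_comm]
    exact (inv_chebNode_sub_ge hw h).trans (le_abs_self _)
  · exact (inv_chebNode_sub_ge hw h).trans (le_abs_self _)

theorem one_le_sq_coe_sub {n : ℕ} {i j : Fin (n + 1)} (hij : i ≠ j) :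
    (1 : ℝ) ≤ ((i : ℝ) - j) ^ 2 := by
  have h : (1 : ℤ) ≤ (((i : ℕ) : ℤ) - (j : ℕ)) ^ 2 := by
    have : ((i : ℕ) : ℤ) - (j : ℕ) ≠ 0 := sub_ne_zero.2 (by exact_mod_cast Fin.val_ne_of_ne hij)
    exact Int.add_one_le_of_lt (sq_pos_iff.2 this)
  exact_mod_cast h

theorem le_numSteps (n : ℕ) (w : ℝ) (j : Fin (n + 1)) :
    1 / chebNode n w j ≤ numSteps n w j := Nat.le_ceil _

theorem numSteps_lt {n : ℕ} {w : ℝ} (hw : 0 < w) (j : Fin (n + 1)) :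
    (numSteps n w j : ℝ) < 1 / chebNode n w j + 1 :=
  Nat.ceil_lt_add_one (one_div_nonneg.2 (chebNode_pos hw j).le)

theorem numSteps_pos {n : ℕ} {w : ℝ} (hw : 0 < w) (j : Fin (n + 1)) : 0 < numSteps n w j :=
  Nat.ceil_pos.2 (one_div_pos.2 (chebNode_pos hw j))

theorem stepNode_pos {n : ℕ} {w : ℝ} (hw : 0 < w) (j : Fin (n + 1)) : 0 < stepNode n w j :=
  one_div_pos.2 (Nat.cast_pos.2 (numSteps_pos hw j))

theorem stepNode_lt {n : ℕ} {w : ℝ} (hw : 0 < w) (j : Fin (n + 1)) : stepNode n w j < w := by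
  refine lt_of_le_of_lt ?_ (chebNode_lt hw j)
  rw [stepNode, one_div_le (Nat.cast_pos.2 (numSteps_pos hw j)) (chebNode_pos hw j)]
  exact le_numSteps n w j

theorem four_le_sq_div {n : ℕ} {w : ℝ} (hw : 0 < w) (hwn : w * (n + 1) ^ 2 ≤ 1 / 4)
    {i j : Fin (n + 1)} (hij : i ≠ j) : 4 ≤ ((i : ℝ) - j) ^ 2 / (w * (n + 1) ^ 2) := by
  rw [le_div_iff₀ (by positivity)]
  linarith [one_le_sq_coe_sub hij]

theorem numSteps_strictAnti {n : ℕ} {w : ℝ} (hw : 0 < w) (hwn : w * (n + 1) ^ 2 ≤ 1 / 4) :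
    StrictAnti (numSteps n w) := by
  intro j i hji
  have h1 := inv_chebNode_sub_ge hw hji
  have h2 := four_le_sq_div hw hwn hji.ne'
  have h3 := le_numSteps n w j
  have h4 := numSteps_lt hw i
  exact_mod_cast (by linarith : (numSteps n w i : ℝ) < numSteps n w j)

theorem stepNode_strictMono {n : ℕ} {w : ℝ} (hw : 0 < w) (hwn : w * (n + 1) ^ 2 ≤ 1 / 4) :
    StrictMono (stepNode n w) := fun _ i hji =>
  one_div_lt_one_div_of_lt (Nat.cast_pos.2 (numSteps_pos hw i))
    (Nat.cast_lt.2 (numSteps_strictAnti hw hwn hji))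

theorem maxDepth_eq {n : ℕ} {w : ℝ} (hw : 0 < w) (hwn : w * (n + 1) ^ 2 ≤ 1 / 4) :
    maxDepth n w = numSteps n w 0 :=
  le_antisymm (Finset.sup_le fun j _ => (numSteps_strictAnti hw hwn).antitone (Fin.zero_le j))
    (Finset.le_sup (Finset.mem_univ 0))

theorem chebNode_zero_eq (n : ℕ) (w : ℝ) :
    chebNode n w 0 = w * Real.sin (Real.pi / (4 * (n + 1))) ^ 2 := by
  have h : chebAngle n 0 = 2 * (Real.pi / (4 * (n + 1))) := by
    simp only [chebAngle, Fin.val_zero, Nat.cast_zero]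
    field_simp
    ring
  rw [chebNode_eq, h, Real.cos_two_mul', Real.cos_sq']
  ring

theorem le_numSteps_zero {n : ℕ} {w : ℝ} (hw : 0 < w) :
    ((n : ℝ) + 1) ^ 2 / w ≤ numSteps n w 0 := by
  refine le_trans ?_ (le_numSteps n w 0)
  have h0 := chebNode_pos hw (0 : Fin (n + 1))
  have hpi := Real.pi_pos
  rw [le_div_iff₀ h0, chebNode_zero_eq]
  have h1 : Real.sin (Real.pi / (4 * (n + 1))) ≤ 1 / ((n : ℝ) + 1) := by
    refine (Real.sin_le (by positivity)).trans ?_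
    rw [div_le_div_iff₀ (by positivity) (by positivity)]
    nlinarith [Real.pi_le_four]
  have h2 : 0 ≤ Real.sin (Real.pi / (4 * (n + 1))) :=
    Real.sin_nonneg_of_nonneg_of_le_pi (by positivity)
      (div_le_self hpi.le (by nlinarith [(Nat.cast_nonneg n : (0 : ℝ) ≤ n)]))
  calc ((n : ℝ) + 1) ^ 2 / w * (w * Real.sin (Real.pi / (4 * (n + 1))) ^ 2)
      ≤ ((n : ℝ) + 1) ^ 2 / w * (w * (1 / ((n : ℝ) + 1)) ^ 2) := by gcongr
    _ = 1 := by field_simp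

theorem numSteps_zero_le {n : ℕ} {w : ℝ} (hw : 0 < w) (hwn : w * (n + 1) ^ 2 ≤ 1 / 4) :
    (numSteps n w 0 : ℝ) ≤ 5 * (((n : ℝ) + 1) ^ 2 / w) := by
  have h0 := chebNode_pos hw (0 : Fin (n + 1))
  have hpi := Real.pi_pos
  have hn : (0 : ℝ) ≤ n := n.cast_nonneg
  have h1 : 1 / (2 * ((n : ℝ) + 1)) ≤ Real.sin (Real.pi / (4 * (n + 1))) := by
    refine le_trans (le_of_eq ?_) (Real.mul_le_sin (by positivity)
      (div_le_div_of_nonneg_left hpi.le (by norm_num) (by linarith)))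
    field_simp
    ring
  have h2 : 1 / chebNode n w 0 ≤ 4 * (((n : ℝ) + 1) ^ 2 / w) := by
    rw [div_le_iff₀ h0, chebNode_zero_eq]
    calc (1 : ℝ) = 4 * (((n : ℝ) + 1) ^ 2 / w) * (w * (1 / (2 * ((n : ℝ) + 1))) ^ 2) := by
          field_simp; norm_num
      _ ≤ _ := by gcongr
  have h3 : 1 ≤ ((n : ℝ) + 1) ^ 2 / w := by
    rw [le_div_iff₀ hw]
    have h4 : (1 : ℝ) ≤ ((n : ℝ) + 1) ^ 2 := by nlinarith
    have h5 : w ≤ w * ((n : ℝ) + 1) ^ 2 := le_mul_of_one_le_right hw.le h4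
    linarith
  linarith [numSteps_lt hw (0 : Fin (n + 1))]

/-! ### Bounds on the extrapolation weights -/

open Polynomial in
/-- The extrapolation weights at the exact Chebyshev nodes. The nodal polynomial is a multiple of
the Chebyshev polynomial `T_{n+1}`, whose derivative at a node is `± (n + 1) / sin θⱼ`. -/
theorem abs_weight_chebNode (n : ℕ) {w : ℝ} (hw : 0 < w) (j : Fin (n + 1)) :
    |weight (chebNode n w) j| =
      Real.sin (chebAngle n j) / ((n + 1) * (1 - Real.cos (chebAngle n j))) := by
  set v : Fin (n + 1) → ℝ := fun i => Real.cos (chebAngle n i) with hv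
  have hinj : Function.Injective v := by
    intro i i' h
    have := Real.injOn_cos ⟨(chebAngle_pos n i).le, (chebAngle_lt_pi n i).le⟩
      ⟨(chebAngle_pos n i').le, (chebAngle_lt_pi n i').le⟩ h
    have h2 := half_chebAngle_sub n i i'
    rw [this, sub_self, zero_div, mul_zero, eq_comm, div_eq_zero_iff, sub_eq_zero] at h2
    rcases h2 with h2 | h2
    · exact Fin.ext (by exact_mod_cast h2)
    · exact absurd h2 (by positivity)
  set a : ℝ := (Chebyshev.T ℝ (n + 1 : ℕ)).leadingCoeff with ha
  have hdeg : (Chebyshev.T ℝ (n + 1 : ℕ)).degree = (n + 1 : ℕ) := by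
    rw [Chebyshev.degree_T]; rfl
  have hT : Chebyshev.T ℝ (n + 1 : ℕ) = C a * Lagrange.nodal Finset.univ v := by
    have hmon := Lagrange.nodal_monic (s := Finset.univ) (v := v)
    have hT0 : Chebyshev.T ℝ (n + 1 : ℕ) ≠ 0 := by
      intro h
      have h1 := Chebyshev.T_eval_one (R := ℝ) (n + 1 : ℕ)
      rw [h, eval_zero] at h1
      exact zero_ne_one h1
    have ha0 : a ≠ 0 := leadingCoeff_ne_zero.2 hT0
    have hdn : (C a * Lagrange.nodal Finset.univ v).degree = (n + 1 : ℕ) := by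
      rw [degree_C_mul ha0, Lagrange.degree_nodal, Finset.card_univ, Fintype.card_fin]
    refine eq_of_degree_sub_lt_of_eval_index_eq Finset.univ hinj.injOn ?_ fun i _ => ?_
    · rw [Finset.card_univ, Fintype.card_fin, ← hdeg]
      refine degree_sub_lt_left (hdeg.trans hdn.symm) hT0 ?_
      rw [leadingCoeff_mul, leadingCoeff_C, hmon.leadingCoeff, mul_one]
    · rw [eval_mul, Lagrange.eval_nodal_at_node (Finset.mem_univ i), mul_zero, hv,
        Chebyshev.T_real_cos, Real.cos_eq_zero_iff]
      refine ⟨i, ?_⟩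
      simp only [chebAngle]
      push_cast
      field_simp
  have hsin : 0 < Real.sin (chebAngle n j) :=
    Real.sin_pos_of_pos_of_lt_pi (chebAngle_pos n j) (chebAngle_lt_pi n j)
  have hcos : ∀ i, 0 < 1 - Real.cos (chebAngle n i) := fun i => by
    have h1 := Real.cos_lt_cos_of_nonneg_of_le_pi le_rfl (chebAngle_lt_pi n i).le
      (chebAngle_pos n i)
    rw [Real.cos_zero] at h1
    linarith
  have h1 : a * ((1 - v j) * ∏ i ∈ Finset.univ.erase j, (1 - v i)) = 1 := by
    have := Chebyshev.T_eval_one (R := ℝ) (n + 1 : ℕ)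
    rw [hT, eval_mul, eval_C, Lagrange.eval_nodal,
      ← Finset.mul_prod_erase Finset.univ _ (Finset.mem_univ j)] at this
    exact this
  have h2 : |a * ∏ i ∈ Finset.univ.erase j, (v j - v i)| * Real.sin (chebAngle n j) = n + 1 := by
    have hd : eval (v j) (derivative (Chebyshev.T ℝ (n + 1 : ℕ))) =
        a * ∏ i ∈ Finset.univ.erase j, (v j - v i) := by
      rw [hT, derivative_C_mul, eval_mul, eval_C,
        Lagrange.eval_nodal_derivative_eval_node_eq (Finset.mem_univ j), Lagrange.eval_nodal]
    rw [← hd, Chebyshev.T_derivative_eq_U, ← abs_of_pos hsin, ← abs_mul]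
    have hU := Chebyshev.U_real_cos (chebAngle n j) n
    have hn1 : ((n + 1 : ℕ) : ℤ) - 1 = n := by push_cast; ring
    rw [hn1, eval_mul, mul_assoc, hU, abs_mul]
    have hang : ((n : ℤ) + 1 : ℝ) * chebAngle n j = j * Real.pi + Real.pi / 2 := by
      simp only [chebAngle]
      push_cast
      field_simp
    rw [hang, Real.sin_add_pi_div_two, Real.abs_cos_eq_one_iff.2 ⟨j, by push_cast; ring⟩, mul_one]
    simp
    positivity
  have hw2 : w / 2 ≠ 0 := (half_pos hw).ne'
  have h3 : weight (chebNode n w) j =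
      (∏ i ∈ Finset.univ.erase j, (1 - v i)) / ∏ i ∈ Finset.univ.erase j, (v j - v i) := by
    rw [weight_eq_prod, ← Finset.prod_div_distrib]
    refine Finset.prod_congr rfl fun i _ => ?_
    rw [chebNode_eq, chebNode_eq, ← mul_sub, mul_div_mul_left _ _ hw2]
    congr 1
    ring
  have ha0 : a ≠ 0 := left_ne_zero_of_mul_eq_one h1
  have hn : (0 : ℝ) < n + 1 := by positivity
  have hne : a * ∏ i ∈ Finset.univ.erase j, (v j - v i) ≠ 0 := by
    intro h; rw [h, abs_zero, zero_mul] at h2; exact hn.ne h2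
  have hcj := hcos j
  have h4 : weight (chebNode n w) j * (1 - v j) * (a * ∏ i ∈ Finset.univ.erase j, (v j - v i)) =
      1 := by
    have := right_ne_zero_of_mul hne
    refine Eq.trans ?_ h1
    rw [h3]
    field_simp
  have h5 := congrArg abs h4
  rw [abs_mul, abs_mul, abs_of_pos hcj, abs_one] at h5
  rw [eq_div_iff (by positivity), ← h2]
  calc _ = (|weight (chebNode n w) j| * (1 - v j) *
        |a * ∏ i ∈ Finset.univ.erase j, (v j - v i)|) * Real.sin (chebAngle n j) := by ring
    _ = _ := by rw [h5, one_mul]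

theorem abs_weight_chebNode_le (n : ℕ) {w : ℝ} (hw : 0 < w) (j : Fin (n + 1)) :
    |weight (chebNode n w) j| ≤ 2 / (2 * j + 1) := by
  rw [abs_weight_chebNode n hw]
  have hpi := Real.pi_pos
  have hθ := chebAngle_pos n j
  have hθ' := chebAngle_lt_pi n j
  set t := chebAngle n j / 2 with ht
  have h2t : chebAngle n j = 2 * t := by rw [ht]; ring
  have hs : 2 / Real.pi * t ≤ Real.sin t := Real.mul_le_sin (by positivity) (by linarith)
  have ht' : 2 / Real.pi * t = (2 * j + 1) / (2 * (n + 1)) := by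
    rw [ht, chebAngle]; field_simp
  rw [ht'] at hs
  have hs0 : 0 < Real.sin t := lt_of_lt_of_le (by positivity) hs
  have hc : Real.cos t ≤ 1 := Real.cos_le_one t
  rw [h2t, Real.sin_two_mul, Real.cos_two_mul', Real.cos_sq']
  have e : 2 * Real.sin t * Real.cos t /
      (((n : ℝ) + 1) * (1 - (1 - Real.sin t ^ 2 - Real.sin t ^ 2))) =
      Real.cos t / ((n + 1) * Real.sin t) := by
    have : (1 - (1 - Real.sin t ^ 2 - Real.sin t ^ 2)) = 2 * Real.sin t ^ 2 := by ring
    rw [this]; field_simp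
  rw [e]
  calc Real.cos t / ((n + 1) * Real.sin t) ≤ 1 / ((n + 1) * ((2 * j + 1) / (2 * (n + 1)))) := by
        gcongr
    _ = _ := by field_simp

/-- The inverse squares of the distances of an integer to the other integers sum to at most `4`. -/
theorem sum_inv_sq_sub_le (n : ℕ) (j : Fin (n + 1)) :
    ∑ i ∈ Finset.univ.erase j, (((i : ℝ) - j) ^ 2)⁻¹ ≤ 4 := by
  have hhalf : ∀ m : ℕ, ∑ r ∈ Finset.range m, (((r : ℝ) + 1) ^ 2)⁻¹ ≤ 2 := by
    intro m
    have h := sum_Ioo_inv_sq_le (α := ℝ) 0 (m + 1)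
    have hI : Finset.Ioo 0 (m + 1) = Finset.Ico 1 (m + 1) := by
      ext i; simp only [Finset.mem_Ioo, Finset.mem_Ico]; omega
    rw [hI, Finset.sum_Ico_eq_sum_range, Nat.cast_zero, zero_add, div_one] at h
    refine le_trans (le_of_eq ?_) h
    refine Finset.sum_congr (by simp) fun r _ => ?_
    push_cast
    ring_nf
  rw [Finset.sum_erase _ (by simp), Fin.sum_univ_eq_sum_range (fun i => (((i : ℝ) - j) ^ 2)⁻¹)]
  obtain ⟨m, hm⟩ : ∃ m, n + 1 = (j + 1) + m := ⟨n - j, by omega⟩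
  have hr : Finset.range (n + 1) = Finset.range ((j + 1) + m) := by rw [← hm]
  rw [hr, Finset.sum_range_add, Finset.sum_range_succ, ← Finset.sum_range_reflect]
  have h1 : ∑ r ∈ Finset.range (j : ℕ), ((((j - 1 - r : ℕ) : ℝ) - j) ^ 2)⁻¹ =
      ∑ r ∈ Finset.range (j : ℕ), (((r : ℝ) + 1) ^ 2)⁻¹ := by
    refine Finset.sum_congr rfl fun r hr => ?_
    have hr' := Finset.mem_range.1 hr
    rw [Nat.cast_sub (by omega), Nat.cast_sub (by omega)]
    push_cast
    ring_nf
  have h2 : ∑ r ∈ Finset.range m, ((((j + 1 + r : ℕ) : ℝ) - j) ^ 2)⁻¹ =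
      ∑ r ∈ Finset.range m, (((r : ℝ) + 1) ^ 2)⁻¹ := by
    refine Finset.sum_congr rfl fun r hr => ?_
    push_cast
    ring_nf
  rw [h1, h2, sub_self]
  have := hhalf j
  have := hhalf m
  norm_num
  linarith

/-- Rounding the numbers of steps to integers changes the extrapolation weights by at most a
constant factor, as long as the gaps between consecutive exact step numbers are bounded below. -/
theorem abs_weight_stepNode_le {n : ℕ} {w : ℝ} (hw : 0 < w) (hwn : w * (n + 1) ^ 2 ≤ 1 / 4)
    (j : Fin (n + 1)) :
    |weight (stepNode n w) j| ≤ Real.exp 3 * |weight (chebNode n w) j| := by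
  rw [weight_eq_prod, weight_eq_prod, Finset.abs_prod, Finset.abs_prod]
  -- `δ i` bounds the inverse gap between the exact step numbers at the nodes `i` and `j`
  set δ : Fin (n + 1) → ℝ := fun i => w * (n + 1) ^ 2 * (((i : ℝ) - j) ^ 2)⁻¹ with hδ
  have hfac : ∀ i ∈ Finset.univ.erase j, |stepNode n w i / (stepNode n w i - stepNode n w j)| ≤
      Real.exp (w + 2 * δ i) * |chebNode n w i / (chebNode n w i - chebNode n w j)| := by
    intro i hi
    have hij : i ≠ j := Finset.ne_of_mem_erase hi
    have hxi := chebNode_pos hw i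
    have hxj := chebNode_pos hw j
    have hki : (0 : ℝ) < numSteps n w i := Nat.cast_pos.2 (numSteps_pos hw i)
    have hkj : (0 : ℝ) < numSteps n w j := Nat.cast_pos.2 (numSteps_pos hw j)
    have hgap := abs_inv_chebNode_sub_ge hw hij
    have h4 := four_le_sq_div hw hwn hij
    set g := |1 / chebNode n w j - 1 / chebNode n w i| with hg
    have hg4 : 4 ≤ g := h4.trans hgap
    -- rounding up both step numbers changes their difference by at most `1`
    have hkg : g - 1 ≤ |(numSteps n w j : ℝ) - numSteps n w i| := by
      have a1 := le_numSteps n w i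
      have a2 := numSteps_lt hw i
      have a3 := le_numSteps n w j
      have a4 := numSteps_lt hw j
      have : |(1 / chebNode n w j - 1 / chebNode n w i) -
          ((numSteps n w j : ℝ) - numSteps n w i)| ≤ 1 := abs_le.2 ⟨by linarith, by linarith⟩
      have := abs_sub_abs_le_abs_sub (1 / chebNode n w j - 1 / chebNode n w i)
        ((numSteps n w j : ℝ) - numSteps n w i)
      linarith
    have e1 : |stepNode n w i / (stepNode n w i - stepNode n w j)| =
        numSteps n w j / |(numSteps n w j : ℝ) - numSteps n w i| := by
      rw [← abs_of_pos hkj, ← abs_div, abs_of_pos hkj, stepNode, stepNode,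
        div_sub_div _ _ hki.ne' hkj.ne', one_mul, mul_one]
      congr 1
      field_simp
    have e2 : |chebNode n w i / (chebNode n w i - chebNode n w j)| = (1 / chebNode n w j) / g := by
      rw [← abs_of_pos (one_div_pos.2 hxj), hg, ← abs_div,
        div_sub_div _ _ hxj.ne' hxi.ne', one_mul, mul_one]
      congr 1
      field_simp
    have hδ0 : 0 ≤ δ i := by positivity
    have hδg : 1 ≤ δ i * g := by
      have : δ i = 1 / (((i : ℝ) - j) ^ 2 / (w * (n + 1) ^ 2)) := by
        rw [hδ, one_div_div, div_eq_mul_inv]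
      rw [this, one_div_mul_eq_div, le_div_iff₀ (by linarith), one_mul]
      exact hgap
    have hδ4 : δ i ≤ 1 / 4 := by
      have h1 := one_le_sq_coe_sub hij
      have : (((i : ℝ) - j) ^ 2)⁻¹ ≤ 1 := inv_le_one_of_one_le₀ h1
      have h0 : 0 ≤ w * ((n : ℝ) + 1) ^ 2 := by positivity
      calc δ i ≤ w * (n + 1) ^ 2 * 1 := by simp only [hδ]; gcongr
        _ ≤ 1 / 4 := by linarith
    have hk : (numSteps n w j : ℝ) ≤ Real.exp w * (1 / chebNode n w j) := by
      have h1 : (1 : ℝ) ≤ w * (1 / chebNode n w j) := by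
        rw [mul_one_div, le_div_iff₀ hxj]; linarith [chebNode_lt hw j]
      have h2 := Real.add_one_le_exp w
      have h3 : (0 : ℝ) < 1 / chebNode n w j := one_div_pos.2 hxj
      nlinarith [numSteps_lt hw j]
    have hgexp : g ≤ Real.exp (2 * δ i) * (g - 1) := by
      have h1 := Real.add_one_le_exp (2 * δ i)
      nlinarith
    rw [e1, e2, Real.exp_add]
    have hg1 : 0 < g - 1 := by linarith
    calc (numSteps n w j : ℝ) / |(numSteps n w j : ℝ) - numSteps n w i|
        ≤ Real.exp w * (1 / chebNode n w j) / (g - 1) := by gcongr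
      _ ≤ Real.exp w * (1 / chebNode n w j) * (Real.exp (2 * δ i) / g) := by
          rw [div_eq_mul_inv]
          gcongr
          rw [inv_le_iff_one_le_mul₀ hg1, div_mul_eq_mul_div, le_div_iff₀ (by linarith), one_mul]
          exact hgexp
      _ = _ := by ring
  refine (Finset.prod_le_prod (fun _ _ => abs_nonneg _) hfac).trans ?_
  -- the exponents `w + 2 δ i` add up to at most `1 / 4 + 2 ≤ 3`
  rw [Finset.prod_mul_distrib, ← Real.exp_sum]
  gcongr
  rw [Finset.sum_add_distrib, ← Finset.mul_sum, ← Finset.mul_sum, Finset.sum_const,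
    Finset.card_erase_of_mem (Finset.mem_univ j), Finset.card_univ, Fintype.card_fin,
    Nat.add_sub_cancel, nsmul_eq_mul]
  have h1 := sum_inv_sq_sub_le n j
  have h0 : 0 ≤ w * ((n : ℝ) + 1) ^ 2 := by positivity
  have h2 : w * ((n : ℝ) + 1) ^ 2 * ∑ i ∈ Finset.univ.erase j, (((i : ℝ) - j) ^ 2)⁻¹ ≤
      1 / 4 * 4 := by gcongr
  have h3 : (n : ℝ) * w ≤ 1 / 4 := by
    have hn : (0 : ℝ) ≤ n := n.cast_nonneg
    nlinarith [mul_nonneg hw.le (by nlinarith : 0 ≤ ((n : ℝ) + 1) ^ 2 - n)]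
  linarith

theorem abs_weight_stepNode_le_div {n : ℕ} {w : ℝ} (hw : 0 < w) (hwn : w * (n + 1) ^ 2 ≤ 1 / 4)
    (j : Fin (n + 1)) : |weight (stepNode n w) j| ≤ 2 * Real.exp 3 * (1 / (j + 1)) := by
  have hj : (0 : ℝ) ≤ j := Nat.cast_nonneg _
  calc |weight (stepNode n w) j| ≤ Real.exp 3 * (2 / (2 * j + 1)) :=
        (abs_weight_stepNode_le hw hwn j).trans (by gcongr; exact abs_weight_chebNode_le n hw j)
    _ ≤ Real.exp 3 * (2 / (j + 1)) := by gcongr; linarith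
    _ = _ := by ring

theorem sum_abs_weight_stepNode_le {n : ℕ} {w : ℝ} (hw : 0 < w)
    (hwn : w * (n + 1) ^ 2 ≤ 1 / 4) :
    ∑ j, |weight (stepNode n w) j| ≤ 2 * Real.exp 3 * (n + 1) := by
  calc ∑ j, |weight (stepNode n w) j| ≤ ∑ _j : Fin (n + 1), 2 * Real.exp 3 := by
        refine Finset.sum_le_sum fun j _ => (abs_weight_stepNode_le_div hw hwn j).trans ?_
        refine mul_le_of_le_one_right (by positivity) ?_
        rw [div_le_one (by positivity)]
        linarith [(Nat.cast_nonneg _ : (0 : ℝ) ≤ ((j : ℕ) : ℝ))]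
    _ = _ := by simp; ring

theorem sum_sq_weight_stepNode_le {n : ℕ} {w : ℝ} (hw : 0 < w)
    (hwn : w * (n + 1) ^ 2 ≤ 1 / 4) :
    ∑ j, weight (stepNode n w) j ^ 2 ≤ 20 * Real.exp 3 ^ 2 := by
  have h1 : ∑ j : Fin (n + 1), ((((j : ℝ) + 1)) ^ 2)⁻¹ ≤ 5 := by
    -- the distances of `0` to the other elements of `{0, …, n + 1}` are `1, …, n + 1`
    have h := sum_inv_sq_sub_le (n + 1) 0
    rw [Finset.sum_erase _ (by simp), Fin.sum_univ_succ] at h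
    simp only [Fin.val_zero, Nat.cast_zero, sub_zero, Fin.val_succ, Nat.cast_add, Nat.cast_one] at h
    norm_num at h
    linarith
  calc ∑ j, weight (stepNode n w) j ^ 2
      ≤ ∑ j : Fin (n + 1), (2 * Real.exp 3) ^ 2 * ((((j : ℝ) + 1)) ^ 2)⁻¹ := by
        refine Finset.sum_le_sum fun j _ => ?_
        rw [← sq_abs]
        refine (pow_le_pow_left₀ (abs_nonneg _) (abs_weight_stepNode_le_div hw hwn j) 2).trans ?_
        rw [mul_pow, one_div, inv_pow]
    _ ≤ (2 * Real.exp 3) ^ 2 * 5 := by rw [← Finset.mul_sum]; gcongr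
    _ = _ := by ring

/-! ### Concentration of the extrapolated sample means -/

/-- Hoeffding's inequality for a weighted sum of sample means. -/
theorem IsShotFamily.measureReal_le_sum_weight_mul {Ω : Type*} [MeasurableSpace Ω] {μ : Measure Ω}
    [IsProbabilityMeasure μ] {n N : ℕ} {X : Fin (n + 1) → Fin N → Ω → ℝ} {m : Fin (n + 1) → ℝ}
    {α : ℝ} (h : IsShotFamily μ X m α) (hα : 0 < α) (hN : 0 < N) {γ : Fin (n + 1) → ℝ} {G t : ℝ}
    (hγ : 0 < ∑ j, γ j ^ 2) (hG : ∑ j, γ j ^ 2 ≤ G) (ht : 0 ≤ t) :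
    μ.real {ω | t ≤ ∑ j, γ j * (sampleMean X ω j - m j)} ≤
      Real.exp (-(t ^ 2 * N / (2 * (α ^ 2 * G)))) := by
  have hN' : (0 : ℝ) < N := Nat.cast_pos.2 hN
  set Y : Fin (n + 1) × Fin N → Ω → ℝ := fun p ω => γ p.1 / N * (X p.1 p.2 ω - m p.1) with hY
  have hind : iIndepFun Y μ :=
    h.indep.comp (fun p x => γ p.1 / N * (x - m p.1)) fun p => by fun_prop
  have hsub : ∀ p ∈ Finset.univ, HasSubgaussianMGF (Y p)
      ((γ p.1 / N) ^ 2 * α ^ 2).toNNReal μ := fun p _ => by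
    have h1 := hasSubgaussianMGF_of_mem_Icc (μ := μ) (X := X p.1 p.2) (a := -α) (b := α)
      (h.measurable p.1 p.2).aemeasurable
      ((h.bounded p.1 p.2).mono fun ω hω => abs_le.1 hω)
    rw [h.mean p.1 p.2] at h1
    convert h1.const_mul (γ p.1 / N) using 1
    refine NNReal.eq ?_
    have hα2 : ‖α - -α‖ / 2 = α := by
      rw [Real.norm_eq_abs, abs_of_pos (by linarith)]; ring
    rw [Real.coe_toNNReal _ (by positivity)]
    change _ = (γ p.1 / N) ^ 2 * (‖α - -α‖ / 2) ^ 2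
    rw [hα2]
  have key := HasSubgaussianMGF.measure_sum_ge_le_of_iIndepFun hind hsub ht
  have hsum : ∀ ω, ∑ p, Y p ω = ∑ j, γ j * (sampleMean X ω j - m j) := by
    intro ω
    rw [Fintype.sum_prod_type]
    refine Finset.sum_congr rfl fun j _ => ?_
    simp only [hY, sampleMean]
    rw [← Finset.mul_sum, Finset.sum_sub_distrib, Finset.sum_const, Finset.card_univ,
      Fintype.card_fin, nsmul_eq_mul]
    field_simp
  simp only [hsum] at key
  refine key.trans (Real.exp_le_exp.2 ?_)
  have hc : ∑ p : Fin (n + 1) × Fin N, ((((γ p.1 / N) ^ 2 * α ^ 2).toNNReal : NNReal) : ℝ) =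
      α ^ 2 * (∑ j, γ j ^ 2) / N := by
    rw [Fintype.sum_prod_type]
    simp only [Finset.sum_const, Finset.card_univ, Fintype.card_fin, nsmul_eq_mul]
    rw [Finset.mul_sum, Finset.sum_div]
    refine Finset.sum_congr rfl fun j _ => ?_
    rw [Real.coe_toNNReal _ (by positivity)]
    field_simp
  rw [NNReal.coe_sum, hc, neg_div, neg_le_neg_iff]
  have e : t ^ 2 / (2 * (α ^ 2 * (∑ j, γ j ^ 2) / N)) =
      t ^ 2 * N / (2 * (α ^ 2 * ∑ j, γ j ^ 2)) := by
    field_simp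
  rw [e]
  gcongr

/-- If the weighted exact means are within `ε / 2` of the target `a`, the stated number of shots makes
each one-sided deviation of the weighted sample means beyond `ε / 2` have probability at most
`(δ / 2)²`. -/
theorem sampleMean_concentration {Ω : Type*} [MeasurableSpace Ω] {μ : Measure Ω}
    [IsProbabilityMeasure μ] {n N : ℕ} {X : Fin (n + 1) → Fin N → Ω → ℝ} {m : Fin (n + 1) → ℝ}
    {α : ℝ} (h : IsShotFamily μ X m α) (hα : 0 < α) {γ : Fin (n + 1) → ℝ} {G ε δ a : ℝ}
    (hγ : 0 < ∑ j, γ j ^ 2) (hG : ∑ j, γ j ^ 2 ≤ G) (hε : 0 < ε) (hδ : 0 < δ) (hδ1 : δ < 1)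
    (hN : 16 * α ^ 2 * G * (1 / ε ^ 2) * Real.log (2 / δ) ≤ N)
    (hbias : |∑ j, m j * γ j - a| ≤ ε / 2) :
    1 - δ < μ.real {ω | |∑ j, sampleMean X ω j * γ j - a| < ε} := by
  have hG0 : 0 < G := hγ.trans_le hG
  have hlog : 0 < Real.log (2 / δ) := Real.log_pos (by rw [lt_div_iff₀ hδ]; linarith)
  have hNpos : (0 : ℝ) < N := lt_of_lt_of_le (by positivity) hN
  have hN0 : 0 < N := Nat.cast_pos.1 hNpos
  have hexp : Real.exp (-((ε / 2) ^ 2 * N / (2 * (α ^ 2 * G)))) ≤ (δ / 2) ^ 2 := by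
    have h1 : 2 * Real.log (2 / δ) ≤ (ε / 2) ^ 2 * N / (2 * (α ^ 2 * G)) := by
      rw [le_div_iff₀ (by positivity)]
      calc 2 * Real.log (2 / δ) * (2 * (α ^ 2 * G))
          = (ε / 2) ^ 2 * (16 * α ^ 2 * G * (1 / ε ^ 2) * Real.log (2 / δ)) := by
            field_simp; norm_num
        _ ≤ _ := by gcongr
    calc _ ≤ Real.exp (-(2 * Real.log (2 / δ))) := Real.exp_le_exp.2 (neg_le_neg h1)
      _ = (δ / 2) ^ 2 := by
        rw [← inv_div, Real.log_inv, mul_neg, neg_neg, mul_comm, Real.exp_mul,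
          Real.exp_log (by positivity), ← Real.rpow_natCast]
        norm_num
  have hup := (h.measureReal_le_sum_weight_mul hα hN0 hγ hG (half_pos hε).le).trans hexp
  have hlo := (h.measureReal_le_sum_weight_mul (γ := fun j => -γ j) hα hN0 (by simpa using hγ)
    (by simpa using hG) (half_pos hε).le).trans hexp
  set U := {ω | ε / 2 ≤ ∑ j, γ j * (sampleMean X ω j - m j)} with hU
  set V := {ω | ε / 2 ≤ ∑ j, -γ j * (sampleMean X ω j - m j)} with hV
  set S := {ω | |∑ j, sampleMean X ω j * γ j - a| < ε} with hS
  have hcover : Sᶜ ⊆ U ∪ V := by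
    intro ω hω
    by_contra hUV
    rw [Set.mem_union, not_or] at hUV
    simp only [hU, hV, Set.mem_ofPred_eq, not_le] at hUV
    apply hω
    have e1 : ∑ j, -γ j * (sampleMean X ω j - m j) = -∑ j, γ j * (sampleMean X ω j - m j) := by
      rw [← Finset.sum_neg_distrib]; exact Finset.sum_congr rfl fun j _ => by ring
    have e2 : ∑ j, sampleMean X ω j * γ j - a =
        ∑ j, γ j * (sampleMean X ω j - m j) + (∑ j, m j * γ j - a) := by
      rw [← add_sub_assoc, ← Finset.sum_add_distrib]
      congr 1
      exact Finset.sum_congr rfl fun j _ => by ring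
    rw [e1] at hUV
    rw [abs_le] at hbias
    simp only [hS, Set.mem_ofPred_eq, e2, abs_lt]
    constructor <;> linarith [hUV.1, hUV.2, hbias.1, hbias.2]
  have hSm : MeasurableSet S := by
    have hm := h.measurable
    have : Measurable fun ω => |∑ j, sampleMean X ω j * γ j - a| := by
      unfold sampleMean
      fun_prop
    exact measurableSet_lt this measurable_const
  have hc : μ.real Sᶜ ≤ (δ / 2) ^ 2 + (δ / 2) ^ 2 :=
    (measureReal_mono hcover).trans ((measureReal_union_le U V).trans (add_le_add hup hlo))
  rw [probReal_compl_eq_one_sub hSm] at hc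
  nlinarith

/-! ### The integrator in the Heisenberg picture -/

section HeisenbergPicture

/-- A completely positive map `X ↦ ∑ᵢ Fᵢ† X Fᵢ` has the operator norm of its value at `1`: this is
the Cauchy–Schwarz inequality for the vectors `(Fᵢ x)ᵢ` and `(Fᵢ y)ᵢ`. -/
theorem norm_sum_star_mul_mul_le {E ι : Type*} [NormedAddCommGroup E] [InnerProductSpace ℂ E]
    [CompleteSpace E] [Fintype ι] (F : ι → E →L[ℂ] E) (X : E →L[ℂ] E) :
    ‖∑ i, star (F i) * X * F i‖ ≤ ‖∑ i, star (F i) * F i‖ * ‖X‖ := by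
  set S := ∑ i, star (F i) * F i with hS
  have hinner : ∀ (Y : E →L[ℂ] E) (x y : E),
      inner ℂ y ((∑ i, star (F i) * Y * F i) x) = ∑ i, inner ℂ (F i y) (Y (F i x)) := by
    intro Y x y
    rw [sum_apply, inner_sum]
    refine Finset.sum_congr rfl fun i _ => ?_
    rw [ContinuousLinearMap.star_eq_adjoint, mul_apply_eq_comp,
      mul_apply_eq_comp, ContinuousLinearMap.adjoint_inner_right]
  have hsq : ∀ x, ∑ i, ‖F i x‖ ^ 2 ≤ ‖S‖ * ‖x‖ ^ 2 := by
    intro x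
    have h1 := hinner 1 x x
    simp only [mul_one, one_apply_eq_self, inner_self_eq_norm_sq_to_K] at h1
    have h2 : ‖inner ℂ x (S x)‖ ≤ ‖S‖ * ‖x‖ ^ 2 := by
      calc _ ≤ ‖x‖ * ‖S x‖ := norm_inner_le_norm _ _
        _ ≤ ‖x‖ * (‖S‖ * ‖x‖) := by gcongr; exact S.le_opNorm x
        _ = _ := by ring
    rw [← hS] at h1
    rw [h1] at h2
    have h3 : ∑ i, ((‖F i x‖ : ℂ)) ^ 2 = ((∑ i, ‖F i x‖ ^ 2 : ℝ) : ℂ) := by push_cast; rfl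
    have h4 : (0 : ℝ) ≤ ∑ i, ‖F i x‖ ^ 2 := by positivity
    change ‖∑ i, ((‖F i x‖ : ℂ)) ^ 2‖ ≤ _ at h2
    rw [h3, Complex.norm_real, Real.norm_eq_abs, abs_of_nonneg h4] at h2
    exact h2
  refine ContinuousLinearMap.opNorm_le_bound _ (by positivity) fun x => ?_
  set y := (∑ i, star (F i) * X * F i) x with hy
  have h1 : ‖y‖ ^ 2 ≤ ‖S‖ * ‖X‖ * ‖x‖ * ‖y‖ := by
    calc ‖y‖ ^ 2 = ‖(inner ℂ y y : ℂ)‖ := by rw [inner_self_eq_norm_sq_to_K]; simp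
      _ = ‖∑ i, inner ℂ (F i y) (X (F i x))‖ := by rw [← hinner, ← hy]
      _ ≤ ∑ i, ‖X‖ * (‖F i y‖ * ‖F i x‖) := by
          refine (norm_sum_le _ _).trans (Finset.sum_le_sum fun i _ => ?_)
          calc _ ≤ ‖F i y‖ * ‖X (F i x)‖ := norm_inner_le_norm _ _
            _ ≤ ‖F i y‖ * (‖X‖ * ‖F i x‖) := by gcongr; exact X.le_opNorm _
            _ = _ := by ring
      _ ≤ ‖X‖ * (√(∑ i, ‖F i y‖ ^ 2) * √(∑ i, ‖F i x‖ ^ 2)) := by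
          rw [← Finset.mul_sum]
          gcongr
          exact Real.sum_mul_le_sqrt_mul_sqrt _ _ _
      _ ≤ ‖X‖ * (√(‖S‖ * ‖y‖ ^ 2) * √(‖S‖ * ‖x‖ ^ 2)) := by
          gcongr <;> exact hsq _
      _ = _ := by
          rw [Real.sqrt_mul (norm_nonneg _), Real.sqrt_mul (norm_nonneg _),
            Real.sqrt_sq (norm_nonneg _), Real.sqrt_sq (norm_nonneg _)]
          have := Real.mul_self_sqrt (norm_nonneg S)
          linear_combination (‖X‖ * ‖x‖ * ‖y‖) * this
  rcases (norm_nonneg y).eq_or_lt with h0 | h0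
  · rw [← h0]; positivity
  · rw [sq] at h1
    exact le_of_mul_le_mul_right h1 h0

variable {d : ℕ}

theorem norm_sum_conjTranspose_mul_mul_le {ι : Type*} [Fintype ι]
    (F : ι → Matrix (Fin d) (Fin d) ℂ) (X : Matrix (Fin d) (Fin d) ℂ) :
    ‖∑ i, (F i)ᴴ * X * F i‖ ≤ ‖∑ i, (F i)ᴴ * F i‖ * ‖X‖ := by
  have h := norm_sum_star_mul_mul_le (fun i => Matrix.toEuclideanCLM (n := Fin d) (𝕜 := ℂ) (F i))
    (Matrix.toEuclideanCLM (n := Fin d) (𝕜 := ℂ) X)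
  simp only [← map_star, ← map_mul, ← map_sum, ← Matrix.cstar_norm_def] at h
  exact h

open scoped MatrixOrder in
/-- The expectation of `X` in a density matrix is bounded by the operator norm of `X`. -/
theorem IsDensityMatrix.norm_trace_mul_le {ρ : Matrix (Fin d) (Fin d) ℂ} (hρ : IsDensityMatrix ρ)
    (X : Matrix (Fin d) (Fin d) ℂ) : ‖(ρ * X).trace‖ ≤ ‖X‖ := by
  obtain ⟨B, hB⟩ := CStarAlgebra.nonneg_iff_eq_star_mul_self.mp hρ.1.nonneg
  rw [Matrix.star_eq_conjTranspose] at hB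
  set v : Fin d → EuclideanSpace ℂ (Fin d) := fun i => WithLp.toLp 2 fun k => star (B i k) with hv
  have hentry : ∀ Y : Matrix (Fin d) (Fin d) ℂ, (ρ * Y).trace =
      ∑ i, inner ℂ (v i) (Matrix.toEuclideanCLM (n := Fin d) (𝕜 := ℂ) Y (v i)) := by
    intro Y
    rw [hB, Matrix.mul_assoc, Matrix.trace_mul_comm, Matrix.trace]
    refine Finset.sum_congr rfl fun i _ => ?_
    rw [EuclideanSpace.inner_eq_star_dotProduct, Matrix.ofLp_toEuclideanCLM]
    simp only [hv, Matrix.diag_apply, Matrix.mul_apply, dotProduct, Matrix.mulVec, Pi.star_apply,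
      star_star, Matrix.conjTranspose_apply, Finset.sum_mul]
    rw [Finset.sum_comm]
    refine Finset.sum_congr rfl fun k _ => ?_
    exact Finset.sum_congr rfl fun _ _ => by ring
  have hone : ∑ i, ‖v i‖ ^ 2 = 1 := by
    have h1 := hentry 1
    rw [mul_one, hρ.2] at h1
    simp only [map_one, one_apply_eq_self, inner_self_eq_norm_sq_to_K] at h1
    change _ = ∑ i, ((‖v i‖ : ℝ) : ℂ) ^ 2 at h1
    exact_mod_cast h1.symm
  rw [hentry X]
  calc _ ≤ ∑ i, ‖v i‖ ^ 2 * ‖X‖ := by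
        refine (norm_sum_le _ _).trans (Finset.sum_le_sum fun i _ => ?_)
        refine (norm_inner_le_norm _ _).trans ?_
        rw [Matrix.cstar_norm_def, sq, mul_assoc]
        refine mul_le_mul_of_nonneg_left ?_ (norm_nonneg _)
        rw [mul_comm]
        exact ContinuousLinearMap.le_opNorm _ _
    _ = ‖X‖ := by rw [← Finset.sum_mul, hone, one_mul]

variable {J : ℕ} (H : Matrix (Fin d) (Fin d) ℂ) (L : Fin J → Matrix (Fin d) (Fin d) ℂ)

/-- The effective non-Hermitian Hamiltonian part `A = -iH - ½ ∑ⱼ Lⱼ† Lⱼ` of the generator. -/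
noncomputable def drift : Matrix (Fin d) (Fin d) ℂ :=
  (-Complex.I) • H - (1 / 2 : ℂ) • ∑ j, (L j)ᴴ * L j

/-- The generator `X ↦ A† X + X A + ∑ⱼ Lⱼ† X Lⱼ` of the dynamics in the Heisenberg picture, as a
continuous linear map. -/
noncomputable def heisenbergGen : Matrix (Fin d) (Fin d) ℂ →L[ℂ] Matrix (Fin d) (Fin d) ℂ :=
  ContinuousLinearMap.mulLeftRight ℂ _ (drift H L)ᴴ 1 +
    ContinuousLinearMap.mulLeftRight ℂ _ 1 (drift H L) +
    ∑ j, ContinuousLinearMap.mulLeftRight ℂ _ (L j)ᴴ (L j)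

/-- The second-order term `X ↦ A† X A` of one integrator step in the Heisenberg picture. -/
noncomputable def heisenbergQuad : Matrix (Fin d) (Fin d) ℂ →L[ℂ] Matrix (Fin d) (Fin d) ℂ :=
  ContinuousLinearMap.mulLeftRight ℂ _ (drift H L)ᴴ (drift H L)

theorem heisenbergGen_apply (X : Matrix (Fin d) (Fin d) ℂ) :
    heisenbergGen H L X =
      (drift H L)ᴴ * X + X * drift H L + ∑ j, (L j)ᴴ * X * L j := by
  simp [heisenbergGen]

theorem heisenbergQuad_apply (X : Matrix (Fin d) (Fin d) ℂ) :
    heisenbergQuad H L X = (drift H L)ᴴ * X * drift H L := by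
  simp [heisenbergQuad]

variable {H}

theorem drift_conjTranspose (hH : H.IsHermitian) :
    (drift H L)ᴴ = Complex.I • H - (1 / 2 : ℂ) • ∑ j, (L j)ᴴ * L j := by
  simp [drift, Matrix.conjTranspose_sub, Matrix.conjTranspose_smul, Matrix.conjTranspose_sum,
    Matrix.conjTranspose_mul, hH.eq]

theorem lindbladian_eq (hH : H.IsHermitian) (ρ : Matrix (Fin d) (Fin d) ℂ) :
    lindbladian H L ρ = drift H L * ρ + ρ * (drift H L)ᴴ + ∑ j, L j * ρ * (L j)ᴴ := by
  rw [drift_conjTranspose L hH, lindbladian, drift, Finset.sum_sub_distrib, ← Finset.smul_sum,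
    Finset.sum_add_distrib, ← Finset.sum_mul, ← Finset.mul_sum]
  simp only [sub_mul, mul_sub, smul_mul_assoc, mul_smul_comm, smul_sub, smul_add, neg_smul,
    neg_mul]
  abel

theorem trace_lindbladian_mul (hH : H.IsHermitian) (ρ X : Matrix (Fin d) (Fin d) ℂ) :
    (lindbladian H L ρ * X).trace = (ρ * heisenbergGen H L X).trace := by
  have cyc : ∀ A B : Matrix (Fin d) (Fin d) ℂ, (A * ρ * B * X).trace = (ρ * (B * X * A)).trace := by
    intro A B
    rw [Matrix.mul_assoc, Matrix.mul_assoc, Matrix.trace_mul_comm, Matrix.mul_assoc]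
  rw [lindbladian_eq L hH, heisenbergGen_apply]
  simp only [add_mul, mul_add, Finset.sum_mul, Finset.mul_sum, Matrix.trace_add, Matrix.trace_sum,
    cyc]
  have h1 := cyc (drift H L) 1
  have h2 := cyc 1 (drift H L)ᴴ
  simp only [mul_one, one_mul] at h1 h2
  rw [h1, h2]
  ring

/-- One integrator step in the Heisenberg picture, written with its Kraus operators. -/
theorem one_add_smul_heisenberg_apply {h : ℝ} (hh : 0 ≤ h) (X : Matrix (Fin d) (Fin d) ℂ) :
    (1 + h • heisenbergGen H L + h ^ 2 • heisenbergQuad H L) X =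
      (krausF0 H L h)ᴴ * X * krausF0 H L h + ∑ j, (krausF L h j)ᴴ * X * krausF L h j := by
  have h0 : krausF0 H L h = 1 + h • drift H L := by rw [krausF0, drift, Complex.coe_smul]
  have hF : ∀ j, krausF L h j = √h • L j := fun j => by rw [krausF, Complex.coe_smul]
  have hs : √h * √h = h := Real.mul_self_sqrt hh
  simp only [h0, hF, add_apply, smul_apply, one_apply_eq_self, heisenbergGen_apply,
    heisenbergQuad_apply, Matrix.conjTranspose_add, Matrix.conjTranspose_one,
    Matrix.conjTranspose_smul, star_trivial, add_mul, mul_add, one_mul, mul_one, smul_mul_assoc,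
    mul_smul_comm, smul_smul, hs, smul_add, Finset.smul_sum, sq]
  abel

theorem trace_krausStep_mul {h : ℝ} (hh : 0 ≤ h) (ρ X : Matrix (Fin d) (Fin d) ℂ) :
    (krausStep H L h ρ * X).trace =
      (ρ * (1 + h • heisenbergGen H L + h ^ 2 • heisenbergQuad H L) X).trace := by
  have cyc : ∀ A B : Matrix (Fin d) (Fin d) ℂ, (A * ρ * B * X).trace = (ρ * (B * X * A)).trace := by
    intro A B
    rw [Matrix.mul_assoc, Matrix.mul_assoc, Matrix.trace_mul_comm, Matrix.mul_assoc]
  rw [one_add_smul_heisenberg_apply L hh, krausStep]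
  simp only [add_mul, mul_add, Finset.sum_mul, Finset.mul_sum, Matrix.trace_add, Matrix.trace_sum,
    cyc]

theorem trace_krausStep_iterate_mul {h : ℝ} (hh : 0 ≤ h) (k : ℕ)
    (ρ X : Matrix (Fin d) (Fin d) ℂ) :
    ((krausStep H L h)^[k] ρ * X).trace =
      (ρ * ((1 + h • heisenbergGen H L + h ^ 2 • heisenbergQuad H L) ^ k) X).trace := by
  induction k generalizing ρ with
  | zero => simp
  | succ k ih =>
    rw [Function.iterate_succ_apply, ih, trace_krausStep_mul L hh, pow_succ' (_ + _ : _ →L[ℂ] _),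
      mul_apply_eq_comp]

theorem heisenbergGen_one (hH : H.IsHermitian) : heisenbergGen H L 1 = 0 := by
  rw [heisenbergGen_apply, drift_conjTranspose L hH, drift]
  simp only [mul_one, one_mul]
  have : ∀ S : Matrix (Fin d) (Fin d) ℂ,
      Complex.I • H - (1 / 2 : ℂ) • S + (-Complex.I • H - (1 / 2 : ℂ) • S) + S = 0 := fun S => by
    module
  exact this _

theorem norm_drift_le {l : ℝ} (hl : 2 * ‖H‖ + 2 * ∑ j, ‖L j‖ ^ 2 ≤ l) :
    2 * ‖drift H L‖ + ∑ j, ‖L j‖ ^ 2 ≤ l := by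
  have h1 : ‖∑ j, (L j)ᴴ * L j‖ ≤ ∑ j, ‖L j‖ ^ 2 := by
    refine (norm_sum_le _ _).trans (Finset.sum_le_sum fun j _ => ?_)
    rw [Matrix.l2_opNorm_conjTranspose_mul_self, sq]
  have h2 : ‖drift H L‖ ≤ ‖H‖ + 1 / 2 * ‖∑ j, (L j)ᴴ * L j‖ := by
    refine (norm_sub_le _ _).trans (le_of_eq ?_)
    rw [norm_smul, norm_smul]
    simp
  linarith

theorem norm_heisenbergQuad_le : ‖heisenbergQuad H L‖ ≤ ‖drift H L‖ ^ 2 := by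
  refine (ContinuousLinearMap.opNorm_mulLeftRight_apply_apply_le _ _ _ _).trans (le_of_eq ?_)
  rw [Matrix.l2_opNorm_conjTranspose, sq]

theorem norm_heisenbergGen_le [NeZero d] {l : ℝ} (hl : 2 * ‖H‖ + 2 * ∑ j, ‖L j‖ ^ 2 ≤ l) :
    ‖heisenbergGen H L‖ ≤ l := by
  have hb := fun x y : Matrix (Fin d) (Fin d) ℂ =>
    ContinuousLinearMap.opNorm_mulLeftRight_apply_apply_le ℂ (Matrix (Fin d) (Fin d) ℂ) x y
  have h1 := hb (drift H L)ᴴ 1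
  have h2 := hb 1 (drift H L)
  rw [norm_one, mul_one, Matrix.l2_opNorm_conjTranspose] at h1
  rw [norm_one, one_mul] at h2
  have h3 : ‖∑ j, ContinuousLinearMap.mulLeftRight ℂ (Matrix (Fin d) (Fin d) ℂ) (L j)ᴴ (L j)‖ ≤
      ∑ j, ‖L j‖ ^ 2 := by
    refine (norm_sum_le _ _).trans (Finset.sum_le_sum fun j _ => (hb _ _).trans (le_of_eq ?_))
    rw [Matrix.l2_opNorm_conjTranspose, sq]
  have h4 := norm_drift_le L hl
  unfold heisenbergGen
  refine (norm_add_le _ _).trans ?_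
  have h5 := norm_add_le (ContinuousLinearMap.mulLeftRight ℂ (Matrix (Fin d) (Fin d) ℂ)
    (drift H L)ᴴ 1) (ContinuousLinearMap.mulLeftRight ℂ _ 1 (drift H L))
  linarith

/-- The Heisenberg generator is dissipative up to second order: `1 + t 𝓛†` differs by `O(t²)` from
a completely positive map which is unital up to `O(t²)`. -/
theorem norm_one_add_smul_heisenbergGen_le [NeZero d] (hH : H.IsHermitian) {t : ℝ} (ht : 0 ≤ t) :
    ‖1 + t • heisenbergGen H L‖ ≤ 1 + 2 * ‖drift H L‖ ^ 2 * t ^ 2 := by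
  set Φ := 1 + t • heisenbergGen H L + t ^ 2 • heisenbergQuad H L with hΦ
  have hquad : ‖t ^ 2 • heisenbergQuad H L‖ ≤ ‖drift H L‖ ^ 2 * t ^ 2 := by
    rw [norm_smul, Real.norm_eq_abs, abs_of_nonneg (by positivity), mul_comm]
    gcongr
    exact norm_heisenbergQuad_le L
  set F : Option (Fin J) → Matrix (Fin d) (Fin d) ℂ := fun i =>
    i.elim (krausF0 H L t) (krausF L t) with hF
  have hΦF : ∀ X, Φ X = ∑ i, (F i)ᴴ * X * F i := fun X => by
    rw [hΦ, one_add_smul_heisenberg_apply L ht, Fintype.sum_option]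
    rfl
  have hone : ‖∑ i, (F i)ᴴ * F i‖ ≤ 1 + ‖drift H L‖ ^ 2 * t ^ 2 := by
    have h1 := hΦF 1
    simp only [mul_one] at h1
    rw [← h1, hΦ]
    simp only [add_apply, smul_apply, one_apply_eq_self, heisenbergGen_one L hH, smul_zero,
      add_zero]
    refine (norm_add_le _ _).trans ?_
    rw [norm_one]
    gcongr
    have h2 := ContinuousLinearMap.le_opNorm (t ^ 2 • heisenbergQuad H L) 1
    rw [norm_one, mul_one] at h2
    exact h2.trans hquad
  have hΦn : ‖Φ‖ ≤ 1 + ‖drift H L‖ ^ 2 * t ^ 2 := by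
    refine ContinuousLinearMap.opNorm_le_bound _ (by positivity) fun X => ?_
    rw [hΦF]
    refine (norm_sum_conjTranspose_mul_mul_le F X).trans ?_
    gcongr
  have e : 1 + t • heisenbergGen H L = Φ - t ^ 2 • heisenbergQuad H L := by
    rw [hΦ]; abel
  rw [e]
  refine (norm_sub_le _ _).trans ?_
  linarith

theorem hasDerivAt_exp_sub_smul_apply {E : Type*} [NormedAddCommGroup E] [NormedSpace ℂ E]
    [CompleteSpace E] (P : E →L[ℂ] E) (x : E) (T t : ℝ) :
    HasDerivAt (fun s : ℝ => NormedSpace.exp ((T - s) • P) x)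
      (-(P (NormedSpace.exp ((T - t) • P) x))) t := by
  let ev : (E →L[ℂ] E) →L[ℝ] E := (ContinuousLinearMap.apply ℂ E x).restrictScalars ℝ
  have h1 := hasDerivAt_exp_smul_const' (𝕂 := ℝ) P (T - t)
  have h2 : HasDerivAt (fun s : ℝ => T - s) (-1) t := (hasDerivAt_id t).const_sub T
  have h3 := ev.hasFDerivAt.comp_hasDerivAt t (h1.scomp t h2)
  refine h3.congr_deriv ?_
  rw [neg_one_smul, map_neg]
  rfl

theorem exp_sub_self_smul_apply {E : Type*} [NormedAddCommGroup E] [NormedSpace ℂ E]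
    (P : E →L[ℂ] E) (x : E) (T : ℝ) : NormedSpace.exp ((T - T) • P) x = x := by
  rw [sub_self, zero_smul, NormedSpace.exp_zero, one_apply_eq_self]

/-- Duality between the Lindblad equation and the Heisenberg picture: along a solution `ρ`, the
expectation `Tr (ρ(t) exp ((T - t) 𝓛†) O)` does not depend on `t`. -/
theorem IsLindbladSolution.trace_mul {ρ₀ : Matrix (Fin d) (Fin d) ℂ} {T : ℝ}
    {ρ : ℝ → Matrix (Fin d) (Fin d) ℂ} (h : IsLindbladSolution H L ρ₀ T ρ) (hH : H.IsHermitian)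
    (hT : 0 ≤ T) (O : Matrix (Fin d) (Fin d) ℂ) :
    (ρ T * O).trace = (ρ₀ * NormedSpace.exp (T • heisenbergGen H L) O).trace := by
  set P := heisenbergGen H L with hP
  set Y : ℝ → Matrix (Fin d) (Fin d) ℂ := fun t => NormedSpace.exp ((T - t) • P) O with hY
  have hYd : ∀ t, HasDerivAt Y (-(P (Y t))) t := hasDerivAt_exp_sub_smul_apply P O T
  let tr : Matrix (Fin d) (Fin d) ℂ →L[ℝ] ℂ :=
    LinearMap.toContinuousLinearMap ((Matrix.traceLinearMap (Fin d) ℂ ℂ).restrictScalars ℝ)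
  have hφ : ∀ t ∈ Set.Icc 0 T,
      HasDerivWithinAt (fun s => (ρ s * Y s).trace) 0 (Set.Icc 0 T) t := by
    intro t ht
    have h1 := (h.deriv t ht).mul (hYd t).hasDerivWithinAt
    have h2 := tr.hasFDerivAt.comp_hasDerivWithinAt t h1
    refine h2.congr_deriv ?_
    change (lindbladian H L (ρ t) * Y t + ρ t * -(P (Y t))).trace = 0
    rw [Matrix.trace_add, trace_lindbladian_mul L hH, mul_neg, Matrix.trace_neg, add_neg_cancel]
  have hconst := constant_of_has_deriv_right_zero
    (fun t ht => (hφ t ht).continuousWithinAt)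
    (fun t ht => (hφ t ⟨ht.1, ht.2.le⟩).mono_of_mem_nhdsWithin (Icc_mem_nhdsGE_of_mem ht))
    T ⟨hT, le_rfl⟩
  simp only [hY, exp_sub_self_smul_apply, sub_zero, h.initial] at hconst
  exact hconst

/-- The integrator outputs as a function of the rescaled step size `1 / k`, together with the exact
value at `0`, extend to a holomorphic function which is bounded on a disc of radius
`1 / (4 (l T)²)`. -/
theorem exists_differentiableOn_expVal {ρ₀ O : Matrix (Fin d) (Fin d) ℂ} {Λ l T : ℝ}
    {ρ : ℝ → Matrix (Fin d) (Fin d) ℂ} (hH : H.IsHermitian) (hO : ‖O‖ ≤ Λ)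
    (hρ₀ : IsDensityMatrix ρ₀) (hl1 : 1 ≤ l) (hl : 2 * ‖H‖ + 2 * ∑ j, ‖L j‖ ^ 2 ≤ l) (hT : 1 ≤ T)
    (hρ : IsLindbladSolution H L ρ₀ T ρ) :
    ∃ f : ℂ → ℂ, DifferentiableOn ℂ f (Metric.ball 0 (1 / (4 * (l * T) ^ 2))) ∧
      (∀ z ∈ Metric.ball (0 : ℂ) (1 / (4 * (l * T) ^ 2)), ‖f z‖ ≤ Real.exp 1 * Λ) ∧
      (f 0).re = expVal (ρ T) O ∧
      ∀ k : ℕ, 0 < k → 1 / (k : ℝ) < 1 / (4 * (l * T) ^ 2) →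
        (f (1 / k)).re = expVal (krausState H L ρ₀ T k) O := by
  have hd : NeZero d := ⟨by
    rintro rfl
    have := hρ₀.2
    simp [Matrix.trace] at this⟩
  have hA := norm_drift_le L hl
  have hJ : 0 ≤ ∑ j, ‖L j‖ ^ 2 := by positivity
  have hQ : ‖heisenbergQuad H L‖ ≤ l ^ 2 / 4 := by
    refine (norm_heisenbergQuad_le L).trans ?_
    have : ‖drift H L‖ ≤ l / 2 := by linarith
    calc ‖drift H L‖ ^ 2 ≤ (l / 2) ^ 2 := by gcongr
      _ = _ := by ring
  obtain ⟨F, hFd, hFb, hF0, hFk⟩ := exists_differentiableOn_interpolating_pow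
    (𝔸 := Matrix (Fin d) (Fin d) ℂ →L[ℂ] Matrix (Fin d) (Fin d) ℂ)
    (zero_lt_one.trans_le hl1) (zero_lt_one.trans_le hT) (one_le_mul_of_one_le_of_one_le hl1 hT)
    (norm_heisenbergGen_le L hl) hQ
    (fun t ht => norm_one_add_smul_heisenbergGen_le L hH ht)
  let Θ : (Matrix (Fin d) (Fin d) ℂ →L[ℂ] Matrix (Fin d) (Fin d) ℂ) →L[ℂ] ℂ :=
    (LinearMap.toContinuousLinearMap (Matrix.traceLinearMap (Fin d) ℂ ℂ)).comp
      ((ContinuousLinearMap.mul ℂ _ ρ₀).comp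
        (ContinuousLinearMap.apply ℂ (Matrix (Fin d) (Fin d) ℂ) O))
  have hΘ : ∀ Φ, Θ Φ = (ρ₀ * Φ O).trace := fun Φ => rfl
  refine ⟨fun z => Θ (F z), Θ.differentiable.comp_differentiableOn hFd, fun z hz => ?_, ?_,
    fun k hk hkR => ?_⟩
  · change ‖Θ (F z)‖ ≤ _
    rw [hΘ]
    refine (hρ₀.norm_trace_mul_le _).trans (((F z).le_opNorm O).trans ?_)
    gcongr
    exact hFb z hz
  · change (Θ (F 0)).re = _
    rw [hΘ, hF0, expVal, hρ.trace_mul L hH (by linarith)]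
  · change (Θ (F (1 / k))).re = _
    rw [hΘ, hFk k hk hkR, expVal, krausState, trace_krausStep_iterate_mul L (by positivity)]

end HeisenbergPicture

/-! ### End-to-end guarantee -/

theorem sum_sq_weight_pos {n : ℕ} {x : Fin (n + 1) → ℝ} (hx : Function.Injective x) :
    0 < ∑ j, weight x j ^ 2 := by
  have h1 := sum_pow_mul_weight hx (Nat.zero_le n)
  simp only [pow_zero, one_mul, if_true] at h1
  obtain ⟨j, _, hj⟩ := Finset.exists_ne_zero_of_sum_ne_zero (h1.trans_ne one_ne_zero)
  exact Finset.sum_pos' (fun i _ => sq_nonneg _) ⟨j, Finset.mem_univ j, by positivity⟩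

/-- The lower bound on the simulation time makes `(l T)² log l` at least a constant multiple of
`n²`. For `m < 2` the factor `log m` may be arbitrarily small, but then `n < 2 K`. -/
theorem mul_sq_le_of_time_bound {K l₀ l T m : ℝ} {n : ℕ} (hK : 0 < K) (hl₀ : 1 < l₀)
    (hl : l₀ ≤ l) (hT : 1 ≤ T) (hm : 1 ≤ m) (hnm : n / K ≤ m)
    (h : m * √(Real.log m) / (l * √(Real.log l)) ≤ T) :
    min (Real.log 2) (Real.log l₀ / 4) / K ^ 2 * n ^ 2 ≤ (l * T) ^ 2 * Real.log l := by
  have hl1 : 1 < l := hl₀.trans_le hl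
  have hlog₀ : 0 < Real.log l₀ := Real.log_pos hl₀
  have hlog : 0 < Real.log l := Real.log_pos hl1
  have hlog2 : 0 < Real.log 2 := Real.log_pos (by norm_num)
  have hn : (0 : ℝ) ≤ n / K := by positivity
  have e : min (Real.log 2) (Real.log l₀ / 4) / K ^ 2 * (n : ℝ) ^ 2 =
      (n / K) ^ 2 * min (Real.log 2) (Real.log l₀ / 4) := by
    field_simp
  rw [e]
  rcases le_or_gt 2 m with h2 | h2
  · have hmlog : 0 ≤ Real.log m := Real.log_nonneg hm
    rw [div_le_iff₀ (mul_pos (by linarith) (Real.sqrt_pos.2 hlog))] at h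
    calc (n / K) ^ 2 * min (Real.log 2) (Real.log l₀ / 4) ≤ m ^ 2 * Real.log m := by
          gcongr
          exact (min_le_left _ _).trans (Real.log_le_log (by norm_num) h2)
      _ = (m * √(Real.log m)) ^ 2 := by rw [mul_pow, Real.sq_sqrt hmlog]
      _ ≤ (T * (l * √(Real.log l))) ^ 2 := by gcongr
      _ = _ := by rw [mul_pow, mul_pow, Real.sq_sqrt hlog.le]; ring
  · have hlT : 1 ≤ l * T := one_le_mul_of_one_le_of_one_le hl1.le hT
    calc (n / K) ^ 2 * min (Real.log 2) (Real.log l₀ / 4) ≤ 2 ^ 2 * (Real.log l₀ / 4) := by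
          gcongr
          · exact hnm.trans h2.le
          · exact min_le_right _ _
      _ = 1 * Real.log l₀ := by ring
      _ ≤ (l * T) ^ 2 * Real.log l := by
          gcongr
          exact one_le_pow₀ hlT

/-- The bias of the extrapolated value, if the window is a small fraction of the disc of radius
`1 / (4 (l T)²)` on which the interpolating function is holomorphic. -/
theorem abs_sum_expVal_mul_weight_sub_le {d J : ℕ} {H : Matrix (Fin d) (Fin d) ℂ}
    {L : Fin J → Matrix (Fin d) (Fin d) ℂ} {ρ₀ O : Matrix (Fin d) (Fin d) ℂ} {Λ l T w : ℝ} {n : ℕ}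
    {ρ : ℝ → Matrix (Fin d) (Fin d) ℂ} (hH : H.IsHermitian) (hO : ‖O‖ ≤ Λ)
    (hρ₀ : IsDensityMatrix ρ₀) (hl1 : 1 ≤ l) (hl : 2 * ‖H‖ + 2 * ∑ j, ‖L j‖ ^ 2 ≤ l) (hT : 1 ≤ T)
    (hρ : IsLindbladSolution H L ρ₀ T ρ) (hw : 0 < w) (hwn : w * (n + 1) ^ 2 ≤ 1 / 4)
    (hwR : w ≤ Real.exp (-2) * (1 / (4 * (l * T) ^ 2) / 2)) :
    |∑ j, expVal (krausState H L ρ₀ T (numSteps n w j)) O * weight (stepNode n w) j -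
      expVal (ρ T) O| ≤ 4 * Λ * Real.exp 4 * Real.exp (-n) := by
  obtain ⟨f, hfd, hfb, hf0, hfk⟩ := exists_differentiableOn_expVal L hH hO hρ₀ hl1 hl hT hρ
  set R := 1 / (4 * (l * T) ^ 2) with hR
  have hRpos : 0 < R := by positivity
  have hq : Real.exp (-2) ≤ 1 / 2 := by
    rw [Real.exp_neg, inv_le_comm₀ (Real.exp_pos _) (by norm_num)]
    linarith [Real.add_one_le_exp (2 : ℝ)]
  have hwR' : w < R := by nlinarith
  have hΛ : 0 ≤ Λ := (norm_nonneg _).trans hO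
  have hbound := norm_sum_weight_sub_le (stepNode_strictMono hw hwn).injective hRpos hfd hfb
    (q := Real.exp (-2)) (by linarith)
    (fun j => by
      rw [abs_of_pos (stepNode_pos hw j)]
      exact (stepNode_lt hw j).le.trans hwR)
    (sum_abs_weight_stepNode_le hw hwn)
  have hval : ∀ j, expVal (krausState H L ρ₀ T (numSteps n w j)) O =
      (f (stepNode n w j)).re := fun j => by
    rw [← hfk _ (numSteps_pos hw j) ((stepNode_lt hw j).trans hwR'), stepNode]
    push_cast
    rfl
  have hre : ∑ j, expVal (krausState H L ρ₀ T (numSteps n w j)) O * weight (stepNode n w) j -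
      expVal (ρ T) O = (∑ j, f (stepNode n w j) * weight (stepNode n w) j - f 0).re := by
    rw [Complex.sub_re, Complex.re_sum, hf0]
    simp only [hval, Complex.re_mul_ofReal]
  rw [hre]
  refine (Complex.abs_re_le_norm _).trans (hbound.trans ?_)
  have h1 : Real.exp (-2) ^ (n + 1) / (1 - Real.exp (-2)) ≤ 2 * Real.exp (-2) ^ (n + 1) := by
    rw [div_le_iff₀ (by linarith)]
    nlinarith [pow_pos (Real.exp_pos (-2)) (n + 1)]
  have h2 : ((n : ℝ) + 1) * Real.exp (-2) ^ (n + 1) ≤ Real.exp (-n) := by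
    have h3 : Real.exp (-2) ^ (n + 1) = Real.exp (-((n : ℝ) + 1)) * Real.exp (-((n : ℝ) + 1)) := by
      rw [← Real.exp_nat_mul, ← Real.exp_add]; push_cast; ring_nf
    have h4 : ((n : ℝ) + 1) * Real.exp (-((n : ℝ) + 1)) ≤ 1 := by
      rw [Real.exp_neg, ← div_eq_mul_inv, div_le_one (Real.exp_pos _)]
      linarith [Real.add_one_le_exp ((n : ℝ) + 1)]
    calc _ = ((n : ℝ) + 1) * Real.exp (-((n : ℝ) + 1)) * Real.exp (-((n : ℝ) + 1)) := by
          rw [h3]; ring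
      _ ≤ 1 * Real.exp (-n) := by gcongr; linarith
      _ = _ := one_mul _
  have h5 : Real.exp 4 = Real.exp 1 * Real.exp 3 := by rw [← Real.exp_add]; norm_num
  calc _ ≤ Real.exp 1 * Λ * (2 * Real.exp 3 * (n + 1)) * (2 * Real.exp (-2) ^ (n + 1)) := by gcongr
    _ = 4 * Λ * Real.exp 4 * (((n : ℝ) + 1) * Real.exp (-2) ^ (n + 1)) := by rw [h5]; ring
    _ ≤ _ := by gcongr

/-- The choice of the constant in `n ≥ Cₙ log (1 / ε)`: the `1` gives the factor `ε`, and
`log (1 + B)` absorbs the constant `B`, as `log (1 / ε) ≥ 1`. -/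
theorem const_mul_exp_neg_le {B ε : ℝ} {n : ℕ} (hB : 0 < B) (hε : 0 < ε)
    (hε1 : ε < Real.exp (-1)) (hn : (1 + Real.log (1 + B)) * Real.log (1 / ε) ≤ n) :
    B * Real.exp (-n) ≤ ε := by
  have hu : 1 ≤ Real.log (1 / ε) := by
    rw [one_div, Real.log_inv]
    have := Real.log_lt_log hε hε1
    rw [Real.log_exp] at this
    linarith
  have hB1 : 0 ≤ Real.log (1 + B) := Real.log_nonneg (by linarith)
  have h1 : Real.log (1 + B) + Real.log (1 / ε) ≤ n := by nlinarith
  calc B * Real.exp (-n) ≤ (1 + B) * Real.exp (-(Real.log (1 + B) + Real.log (1 / ε))) := by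
        gcongr
        linarith
    _ = ε := by
        rw [neg_add, Real.exp_add, Real.exp_neg, Real.exp_log (by linarith), one_div, Real.log_inv,
          neg_neg, Real.exp_log hε]
        field_simp

end LindbladRichardson

open LindbladRichardson in
/-- End-to-end guarantee for Richardson extrapolation of the first-order Kraus-form Lindblad
simulator at perturbed (integer-step) Chebyshev nodes. -/
theorem mainTheorem1 (Λ α l₀ : ℝ) (hΛ : 0 < Λ) (hα : 0 < α) (hl₀ : 1 < l₀) :
    ∃ Cn CS : ℝ, 0 < Cn ∧ 0 < CS ∧ ∀ K : ℝ, 0 < K →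
    ∃ c cd Cd : ℝ, 0 < c ∧ c ≤ 1 ∧ 0 < cd ∧ 0 < Cd ∧
    -- the system, its Lindblad dynamics, and the observable
    ∀ (d J : ℕ) (H : Matrix (Fin d) (Fin d) ℂ) (L : Fin J → Matrix (Fin d) (Fin d) ℂ)
      (ρ₀ O : Matrix (Fin d) (Fin d) ℂ) (ρ : ℝ → Matrix (Fin d) (Fin d) ℂ) (l T ε : ℝ) (n : ℕ),
      H.IsHermitian → O.IsHermitian → ‖O‖ ≤ Λ → IsDensityMatrix ρ₀ →
      l₀ ≤ l → 2 * ‖H‖ + 2 * ∑ j, ‖L j‖ ^ 2 ≤ l →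
      IsLindbladSolution H L ρ₀ T ρ →
      0 < ε → ε < Real.exp (-1) →
      -- the number of nodes and the simulation time
      Cn * Real.log (1 / ε) ≤ n →
      1 ≤ T →
      (let m := max (Real.log (1 / ε)) (n / K)
       m * √(Real.log m) / (l * √(Real.log l)) ≤ T) →
      -- the step-size window `[0, w]`
      let w : ℝ := c / ((l * T) ^ 2 * Real.log l)
      -- the nodes are distinct, ordered, and lie in the window
      (StrictMono (stepNode n w) ∧ ∀ j, 0 < stepNode n w j ∧ stepNode n w j < w) ∧
      -- the estimator is accurate with high probability
      (∀ (Ω : Type*) [MeasurableSpace Ω] (μ : Measure Ω) [IsProbabilityMeasure μ]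
          (δ : ℝ) (N : ℕ) (X : Fin (n + 1) → Fin N → Ω → ℝ),
          0 < δ → δ < 1 →
          CS * (1 / ε ^ 2) * Real.log (2 / δ) ≤ N →
          IsShotFamily μ X (fun j => expVal (krausState H L ρ₀ T (numSteps n w j)) O) α →
          1 - δ < μ.real {ω | |richardson (stepNode n w) (sampleMean X ω) - expVal (ρ T) O| < ε}) ∧
      -- the maximum circuit depth
      ((maxDepth n w : ℝ) = 1 / stepNode n w 0 ∧
        cd * ((l * T) ^ 2 * Real.log l * (n : ℝ) ^ 2) ≤ maxDepth n w ∧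
        (maxDepth n w : ℝ) ≤ Cd * ((l * T) ^ 2 * Real.log l * (n : ℝ) ^ 2) ∧
        (n ≤ K * Real.log (1 / ε) →
          cd * ((l * T) ^ 2 * Real.log l * Real.log (1 / ε) ^ 2) ≤ maxDepth n w ∧
          (maxDepth n w : ℝ) ≤ Cd * ((l * T) ^ 2 * Real.log l * Real.log (1 / ε) ^ 2))) := by
  have hlog₀ : 0 < Real.log l₀ := Real.log_pos hl₀
  have hB : 0 < 8 * Λ * Real.exp 4 := by positivity
  have hlogB : 0 ≤ Real.log (1 + 8 * Λ * Real.exp 4) := Real.log_nonneg (by linarith)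
  refine ⟨1 + Real.log (1 + 8 * Λ * Real.exp 4), 16 * α ^ 2 * (20 * Real.exp 3 ^ 2), by linarith,
    by positivity, fun K hK => ?_⟩
  have hlog2 : 0 < Real.log 2 := Real.log_pos (by norm_num)
  set κ := min (Real.log 2) (Real.log l₀ / 4) / K ^ 2 with hκ
  have hκ0 : 0 < κ := div_pos (lt_min hlog2 (by linarith)) (by positivity)
  -- `c` makes `w (n + 1)² ≤ 1 / 4` and `w` a small fraction of the radius of holomorphy
  set c := min 1 (min (Real.exp (-2) * Real.log l₀ / 8) (κ / 16)) with hc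
  have hc0 : 0 < c := lt_min one_pos (lt_min (by positivity) (by positivity))
  have hc1 : c ≤ 1 := min_le_left _ _
  have hc2 : c ≤ Real.exp (-2) * Real.log l₀ / 8 := (min_le_right _ _).trans (min_le_left _ _)
  have hc3 : c ≤ κ / 16 := (min_le_right _ _).trans (min_le_right _ _)
  refine ⟨c, 1, 20 / c * (1 + K ^ 2), hc0, hc1, one_pos, by positivity, ?_⟩
  intro d J H L ρ₀ O ρ l T ε n hH _ hOΛ hρ₀ hl₀l hl hρ hε hε1 hn hT hTm w
  have hl1 : 1 < l := hl₀.trans_le hl₀l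
  have hlog : 0 < Real.log l := Real.log_pos hl1
  have hlogle : Real.log l₀ ≤ Real.log l := Real.log_le_log (by linarith) hl₀l
  have hlT : 0 < l * T := by nlinarith
  set W := (l * T) ^ 2 * Real.log l with hW
  have hW0 : 0 < W := by positivity
  have hw : 0 < w := div_pos hc0 hW0
  have hu : 1 ≤ Real.log (1 / ε) := by
    rw [one_div, Real.log_inv]
    have := Real.log_lt_log hε hε1
    rw [Real.log_exp] at this
    linarith
  have hun : Real.log (1 / ε) ≤ n := by nlinarith
  have hn1 : (1 : ℝ) ≤ n := hu.trans hun
  have hκW : κ * (n : ℝ) ^ 2 ≤ W :=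
    mul_sq_le_of_time_bound hK hl₀ hl₀l hT (hu.trans (le_max_left _ _)) (le_max_right _ _) hTm
  have hn4 : ((n : ℝ) + 1) ^ 2 ≤ 4 * n ^ 2 := by nlinarith
  have hwn : w * ((n : ℝ) + 1) ^ 2 ≤ 1 / 4 := by
    rw [show w = c / W from rfl, div_mul_eq_mul_div, div_le_iff₀ hW0]
    calc c * ((n : ℝ) + 1) ^ 2 ≤ κ / 16 * (4 * n ^ 2) := by gcongr
      _ = 1 / 4 * (κ * n ^ 2) := by ring
      _ ≤ 1 / 4 * W := by gcongr
  have hwR : w ≤ Real.exp (-2) * (1 / (4 * (l * T) ^ 2) / 2) := by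
    rw [show w = c / W from rfl, div_le_iff₀ hW0, hW]
    calc c ≤ Real.exp (-2) * Real.log l / 8 := hc2.trans (by gcongr)
      _ = _ := by field_simp; norm_num
  have hmono := stepNode_strictMono hw hwn
  have hdepth : maxDepth n w = numSteps n w 0 := maxDepth_eq hw hwn
  have hinvw : ∀ x : ℝ, x / w = W * x / c := fun x => by
    rw [show w = c / W from rfl]; field_simp
  have hlow : W * (n : ℝ) ^ 2 ≤ maxDepth n w := by
    rw [hdepth]
    refine le_trans ?_ (le_numSteps_zero hw)
    rw [hinvw, le_div_iff₀ hc0]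
    calc W * (n : ℝ) ^ 2 * c ≤ W * (n : ℝ) ^ 2 * 1 := by gcongr
      _ ≤ W * ((n : ℝ) + 1) ^ 2 := by rw [mul_one]; gcongr; linarith
  have hupp : (maxDepth n w : ℝ) ≤ 20 / c * (W * (n : ℝ) ^ 2) := by
    rw [hdepth]
    refine (numSteps_zero_le hw hwn).trans ?_
    rw [hinvw]
    calc 5 * (W * ((n : ℝ) + 1) ^ 2 / c) ≤ 5 * (W * (4 * n ^ 2) / c) := by gcongr
      _ = _ := by ring
  refine ⟨⟨hmono, fun j => ⟨stepNode_pos hw j, stepNode_lt hw j⟩⟩, ?_, ?_, ?_, ?_,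
    fun hnK => ⟨?_, ?_⟩⟩
  · intro Ω _ μ _ δ N X hδ hδ1 hN hX
    have hbias := abs_sum_expVal_mul_weight_sub_le hH hOΛ hρ₀ hl1.le hl hT hρ hw hwn hwR
    have hsmall := const_mul_exp_neg_le hB hε hε1 hn
    have hconc := sampleMean_concentration hX hα (γ := weight (stepNode n w))
      (sum_sq_weight_pos hmono.injective) (sum_sq_weight_stepNode_le hw hwn) hε hδ hδ1 hN
      (hbias.trans (by linarith))
    simpa only [richardson_eq_sum] using hconc
  · rw [hdepth, stepNode, one_div_one_div]
  · rw [one_mul]; exact hlow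
  · refine hupp.trans ?_
    gcongr
    exact le_mul_of_one_le_right (by positivity) (by nlinarith)
  · rw [one_mul]
    refine le_trans ?_ hlow
    gcongr
  · refine hupp.trans ?_
    calc 20 / c * (W * (n : ℝ) ^ 2) ≤ 20 / c * (W * (K * Real.log (1 / ε)) ^ 2) := by gcongr
      _ = 20 / c * K ^ 2 * (W * Real.log (1 / ε) ^ 2) := by ring
      _ ≤ 20 / c * (1 + K ^ 2) * (W * Real.log (1 / ε) ^ 2) := by
          gcongr
          linarith
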